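/- **Setting.** Let $(\mathcal S,\mathcal A,P,R)$ be a finite episodic MDP with initial-state distribution $\rho$ and a (possibly empty) set of terminal states. Let $\mathcal T:\mathcal S\times\mathcal A\times\mathbb R^h\to\mathbb R^h$ be a trajectory model: if $\tau$ represents the trajectory so far, then $\tau'(a)=\mathcal T(s,a,\tau)$ represents it after action $a$ in state $s$. The agent follows a fixed behaviour policy $\pi(\cdot\mid s,\tau)$, so $Z_t=(s_t,\tau_{t-1})$ is a Markov chain: from $(s,\tau)$ draw $a\sim\pi(\cdot\mid s,\tau)$ and $s'\sim P(\cdot\mid s,a)$, and move to $(s',\mathcal T(s,a,\tau))$ if $s'$ is not terminal; otherwise, and at time $0$, start an episode at $(s_0,0)$, $s_0\sim\rho$. Assume that only finitely many pairs $(s,\tau)$ can be reached. Let $r:\mathcal S\times\mathcal A\to\mathbb R$ be a fixed (hence bounded) reward model and $0\le\gamma<1$. An episodic memory has $N$ slots with fixed keys $k_1,\dots,k_N\in\mathbb R^h$, values $v\in\mathbb R^N$, and a kernel $\langle\cdot,\cdot\rangle$. For a query $\tau$ let $\mathcal N(\tau)$ be a set of $K\ge1$ nearest keys (ties broken by any fixed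 rule). The kernel is nonnegative between keys and queries and has positive sum over every $\mathcal N(\tau)$. Put $B_{i\tau}=\langle k_i,\tau\rangle/\sum_{j\in\mathcal N(\tau)}\langle k_j,\tau\rangle$ for $i\in\mathcal N(\tau)$, and $B_{i\tau}=0$ otherwise. Reading uses the average rule $\mathrm{read}_v(\tau)=\sum_{i\in\mathcal N(\tau)}B_{i\tau}v_i$. Writing $V$ at $\tau$ with rate $\alpha$ replaces $v_i$ by $v_i+\alpha B_{i\tau}(V-v_i)$ for every $i$. The update $\mathrm{refine}$ at $z=(s,\tau)$ with rate $\alpha$ writes $\max_a\bigl[r(s,a)+\gamma\,\mathrm{read}_v(\tau'(a))\bigr]$ at $\tau$. Starting from any $v_0$, let $v_{t+1}$ be obtained from $v_t$ by $\mathrm{refine}$ at $Z_t$ with rate $\alpha_t\ge0$, where $\alpha_t$ is deterministic, $\sum_t\alpha_t=\infty$ and $\sum_t\alpha_t^2<\infty$. Assume moreover that $\sum_t|\alpha_{t+1}-\alpha_t|<\infty$ (for instance that $\alpha_t$ is nonincreasing), or that the chain $Z$ is aperiodic in the sense that its $n$-step transition probabilities from every reachable pair converge as $n\to\infty$. For $f:\mathcal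 S\times\mathbb R^h\to\mathbb R$ and $x=(s,\tau)$ let $$Hf(x)=\frac1K\max_a\sum_{s'}P(s'\mid s,a)\bigl(r(s,a)+\gamma f(s',\mathcal T(s,a,\tau))\bigr)+\frac{K-1}{K}f(x).$$ View $\mathrm{read}_v$ as the function $(s,\tau)\mapsto\mathrm{read}_v(\tau)$. **Claim.** 1. With probability $1$ there are a probability distribution $d$ on pairs $(s,\tau)$, which is the limit of the visit frequencies of $Z_0,\dots,Z_{n-1}$ as $n\to\infty$, and a vector $v^*\in\mathbb R^N$ such that $v_t\to v^*$, $\mathrm{read}_{v_t}(\tau)\to\mathrm{read}_{v^*}(\tau)$ for all $\tau$, and $v^*$ is a fixed point of the expected refine update $v\mapsto\mathbb E_{z\sim d}[\mathrm{refine}_z(v)]$, for every rate. Among the vectors that agree with $v^*$ on the slots $i$ with $B_{i\tau}=0$ for $d$-almost all $(s,\tau)$, it is the only fixed point of the expected update with rate $1$. If $d(z)>0$, $z=(s,\tau)$, and $\mathcal N(\tau)$ is disjoint from $\mathcal N(\tau')$ for all other $z'=(s',\tau')$ with $d(z')>0$, then $(H\,\mathrm{read}_{v^*})(z)=\mathrm{read}_{v^*}(\tau)$.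 2. If $B_{i\tau}=1/K$ for all $i\in\mathcal N(\tau)$, then $\mathrm{refine}$ at $z=(s,\tau)$ with rate $\beta$ changes $\mathrm{read}_v(\tau)$ into $(1-\beta)\,\mathrm{read}_v(\tau)+\beta\,(H\,\mathrm{read}_v)(z)$. 3. $H$ is a sup-norm contraction: if $|f-g|\le C$ everywhere, then $|Hf-Hg|\le\frac{\gamma+K-1}{K}C$ everywhere, and $\frac{\gamma+K-1}{K}<1$. -/

import Mathlib

open MeasureTheory Filter Topology

/-- Vector representations of trajectories. -/
abbrev TrajRep (h : ℕ) : Type := EuclideanSpace ℝ (Fin h)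

/-- An episodic MDP. An episode ends as soon as a state of `terminal` is entered
(`terminal = ∅` is a continuing task). The true `reward` plays no role in `refine`, which uses a
reward model instead. -/
structure EpisodicMDP (S A : Type*) where
  trans : S → A → PMF S
  reward : S → A → ℝ
  init : PMF S
  terminal : Set S

namespace EpisodicMDP

variable {S A : Type*} {h : ℕ}

/-- The law of the pair (current state, representation of the preceding trajectory) at the start
of an episode; the empty trajectory is represented by `0`. -/
noncomputable def startLaw (D : EpisodicMDP S A) : PMF (S × TrajRep h) :=
  D.init.map fun s => (s, 0)

open Classical in
/-- One step of interaction from `z = (s, τ)` under the behaviour policy `π`: draw an action `a`,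
extend the representation to `T s a τ`, draw the next state, and start a new episode if that state
is terminal. -/
noncomputable def step (D : EpisodicMDP S A) (T : S → A → TrajRep h → TrajRep h)
    (π : S × TrajRep h → PMF A) (z : S × TrajRep h) : PMF (S × TrajRep h) :=
  (π z).bind fun a => (D.trans z.1 a).bind fun s' =>
    if s' ∈ D.terminal then D.startLaw else PMF.pure (s', T z.1 a z.2)

/-- The law after `n` further steps, starting from the law `p`. -/
noncomputable def lawFrom (D : EpisodicMDP S A) (T : S → A → TrajRep h → TrajRep h)
    (π : S × TrajRep h → PMF A) (p : PMF (S × TrajRep h)) : ℕ → PMF (S × TrajRep h)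
  | 0 => p
  | n + 1 => (lawFrom D T π p n).bind (D.step T π)

/-- The pairs (state, preceding trajectory) that the agent can meet. -/
def reachable (D : EpisodicMDP S A) (T : S → A → TrajRep h → TrajRep h)
    (π : S × TrajRep h → PMF A) : Set (S × TrajRep h) :=
  {z | ∃ n, D.lawFrom T π D.startLaw n z ≠ 0}

/-- `Z t = (s_t, τ_{t-1})` is the process generated by the interaction: a Markov chain with
initial law `startLaw` and transition law `step`, given by its finite-dimensional distributions. -/
def IsInteraction (D : EpisodicMDP S A) (T : S → A → TrajRep h → TrajRep h)
    (π : S × TrajRep h → PMF A) {Ω : Type*} [MeasurableSpace Ω] (μ : Measure Ω)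
    (Z : ℕ → Ω → S × TrajRep h) : Prop :=
  (∀ t z, MeasurableSet {ω | Z t ω = z}) ∧
  ∀ (n : ℕ) (z : ℕ → S × TrajRep h),
    μ {ω | ∀ j ≤ n, Z j ω = z j} =
      D.startLaw (z 0) * ∏ j ∈ Finset.range n, D.step T π (z j) (z (j + 1))

end EpisodicMDP

/-- The fixed part of an episodic memory with `N` slots: the keys, the kernel, and the function
that retrieves the neighbouring slots of a query. The stored values `v : Fin N → ℝ` are kept
separately. -/
structure EpisodicMemory (N h : ℕ) where
  key : Fin N → TrajRep h
  ker : TrajRep h → TrajRep h → ℝ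
  nbrs : TrajRep h → Finset (Fin N)

namespace EpisodicMemory

variable {S A : Type*} {N h : ℕ}

/-- `nbrs` retrieves `K` nearest slots of every query (ties are broken in any way). -/
def IsKNearest (m : EpisodicMemory N h) (K : ℕ) : Prop :=
  ∀ τ, (m.nbrs τ).card = K ∧
    ∀ i ∈ m.nbrs τ, ∀ j, j ∉ m.nbrs τ → dist (m.key i) τ ≤ dist (m.key j) τ

/-- The kernel is nonnegative and gives every query neighbours of positive total weight. -/
def IsAdmissible (m : EpisodicMemory N h) : Prop :=
  (∀ i τ, 0 ≤ m.ker (m.key i) τ) ∧ ∀ τ, 0 < ∑ j ∈ m.nbrs τ, m.ker (m.key j) τ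

/-- The normalized kernel weight of slot `i` for the query `τ`; it is `0` off the neighbours. -/
noncomputable def weight (m : EpisodicMemory N h) (i : Fin N) (τ : TrajRep h) : ℝ :=
  if i ∈ m.nbrs τ then m.ker (m.key i) τ / ∑ j ∈ m.nbrs τ, m.ker (m.key j) τ else 0

/-- Reading by the weighted average rule. -/
noncomputable def read (m : EpisodicMemory N h) (v : Fin N → ℝ) (τ : TrajRep h) : ℝ :=
  ∑ i ∈ m.nbrs τ, m.weight i τ * v i

/-- Writing the value `V` at `τ` with rate `α`: all neighbours of `τ` move towards `V`, in
proportion to their weights. -/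
noncomputable def write (m : EpisodicMemory N h) (α : ℝ) (τ : TrajRep h) (V : ℝ)
    (v : Fin N → ℝ) : Fin N → ℝ :=
  fun i => v i + α * (V - v i) * m.weight i τ

/-- `max_a r(s, a) + γ * read (T s a τ)` for `z = (s, τ)`. -/
noncomputable def target [Fintype A] [Nonempty A] (m : EpisodicMemory N h)
    (T : S → A → TrajRep h → TrajRep h) (r : S → A → ℝ) (γ : ℝ) (z : S × TrajRep h)
    (v : Fin N → ℝ) : ℝ :=
  Finset.univ.sup' Finset.univ_nonempty fun a => r z.1 a + γ * m.read v (T z.1 a z.2)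

/-- The `refine` update at `z = (s_t, τ_{t-1})` with writing rate `α`. -/
noncomputable def refine [Fintype A] [Nonempty A] (m : EpisodicMemory N h)
    (T : S → A → TrajRep h → TrajRep h) (r : S → A → ℝ) (γ α : ℝ) (z : S × TrajRep h)
    (v : Fin N → ℝ) : Fin N → ℝ :=
  m.write α z.2 (m.target T r γ z v) v

/-- The values stored after the first `t` refinements, made at `z 0, z 1, …` with rates
`α 0, α 1, …`, starting from `v₀`. -/
noncomputable def refineIter [Fintype A] [Nonempty A] (m : EpisodicMemory N h)
    (T : S → A → TrajRep h → TrajRep h) (r : S → A → ℝ) (γ : ℝ) (α : ℕ → ℝ)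
    (z : ℕ → S × TrajRep h) (v₀ : Fin N → ℝ) : ℕ → Fin N → ℝ
  | 0 => v₀
  | t + 1 => m.refine T r γ (α t) (z t) (refineIter m T r γ α z v₀ t)

/-- The expected result of one `refine` update with rate `β` at a random pair of law `d`. -/
noncomputable def meanRefine [Fintype A] [Nonempty A] (m : EpisodicMemory N h)
    (T : S → A → TrajRep h → TrajRep h) (r : S → A → ℝ) (γ β : ℝ) (d : PMF (S × TrajRep h))
    (v : Fin N → ℝ) : Fin N → ℝ :=
  fun i => ∑' z, (d z).toReal * m.refine T r γ β z v i

end EpisodicMemory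

/-- The operator `H` on value functions of `x = (s, τ)`:
`(1/K) max_a ∑_y P_a(x, y) (r(x, a) + γ f(y)) + ((K-1)/K) f(x)`, where action `a` leads from
`(s, τ)` to `(s', T s a τ)` with the probability of the transition from `s` to `s'`. -/
noncomputable def refineOp {S A : Type*} [Fintype S] [Fintype A] [Nonempty A] {h : ℕ}
    (D : EpisodicMDP S A) (T : S → A → TrajRep h → TrajRep h) (r : S → A → ℝ) (γ : ℝ) (K : ℕ)
    (f : S × TrajRep h → ℝ) : S × TrajRep h → ℝ :=
  fun x =>
    1 / (K : ℝ) * (Finset.univ.sup' Finset.univ_nonempty fun a =>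
        ∑ s', (D.trans x.1 a s').toReal * (r x.1 a + γ * f (s', T x.1 a x.2)))
      + ((K : ℝ) - 1) / K * f x

/-! Refinement is the recursion `v (t + 1) = v t + α t • drift (Z t) (v t)`, and the proof of
convergence separates a deterministic argument along one path from a probabilistic one about the
chain.

Deterministic part. Reading is an average, so `target` is `γ`-Lipschitz in sup norm. Let slot `i`
have mean weight `p i` under `d`. If `p i ≠ 0`, a zero of the mean drift has at `i` a weighted
average of targets; with the other slots prescribed, such a zero is the fixed point of a
`γ`-contraction (`exists_mean_drift_eq_zero`), and small Euler steps of the mean drift contract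
towards it (`norm_add_smul_mean_drift_sub_le`). Over a window of total step size `θ`, the true
recursion differs from one Euler step by `O(θ ^ 2)`, because `v` hardly moves, plus the deviation of
the weighted occupation from `d`. If that deviation is negligible, the contraction of order `θ` wins
(`tendsto_of_windowNegligible`). No noise estimate involving `v` is needed.

Probabilistic part (`IsMarkovChain.ae_exists_occupation`). By Poisson's equation the indicator of a
state is `h + (u - P u)` with `h` harmonic. Along the chain `h` is a bounded martingale, whose limit
is the (random) long-run frequency `d x`. The coboundary is a martingale difference plus a
telescoping term. The weighted martingale converges since `∑ α ^ 2 < ∞`; the telescoping term is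
summed by parts if `α` has bounded variation, and otherwise avoided by using convergence of `P ^ n`.
Without either assumption the step sizes could follow the phase of a periodic chain. States of
frequency zero are left for ever, so the slots that only they write are eventually frozen; this
fixes the remaining coordinates of the limit.

The statements about `H` follow because `read` ignores the next state, so that `H` and `refine` use
the same target. -/

/-! ### Deterministic stochastic approximation over windows of step sizes -/

/-- The sequence `b` averages out, with respect to the step sizes `α`, over all late time windows
on which the step sizes add up to at most `1`. -/
def WindowNegligible (α b : ℕ → ℝ) : Prop :=
  ∀ ε > 0, ∃ T, ∀ t ≥ T, ∀ n ≥ t, ∑ s ∈ Finset.Ico t n, α s ≤ 1 →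
    |∑ s ∈ Finset.Ico t n, α s * b s| ≤ ε

namespace WindowNegligible

variable {α b b' : ℕ → ℝ}

theorem add (hb : WindowNegligible α b) (hb' : WindowNegligible α b') :
    WindowNegligible α (fun s => b s + b' s) := by
  intro ε hε
  obtain ⟨T, hT⟩ := hb (ε / 2) (half_pos hε)
  obtain ⟨T', hT'⟩ := hb' (ε / 2) (half_pos hε)
  refine ⟨max T T', fun t ht n hn h1 => ?_⟩
  have e1 := hT t (le_of_max_le_left ht) n hn h1
  have e2 := hT' t (le_of_max_le_right ht) n hn h1
  simp only [mul_add, Finset.sum_add_distrib]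
  exact (abs_add_le _ _).trans (by linarith)

/-- A sequence that is uniformly close to negligible ones is negligible. -/
theorem of_approx (hα : ∀ t, 0 ≤ α t)
    (h : ∀ ε > 0, ∃ b', WindowNegligible α b' ∧ ∀ᶠ s in atTop, |b s - b' s| ≤ ε) :
    WindowNegligible α b := by
  intro ε hε
  obtain ⟨b', hb', hbb⟩ := h (ε / 2) (half_pos hε)
  obtain ⟨T, hT⟩ := hb' (ε / 2) (half_pos hε)
  obtain ⟨T', hT'⟩ := eventually_atTop.1 hbb
  refine ⟨max T T', fun t ht n hn h1 => ?_⟩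
  have e1 := hT t (le_of_max_le_left ht) n hn h1
  have e2 : |∑ s ∈ Finset.Ico t n, α s * (b s - b' s)| ≤ ε / 2 := by
    calc |∑ s ∈ Finset.Ico t n, α s * (b s - b' s)|
        ≤ ∑ s ∈ Finset.Ico t n, α s * (ε / 2) := by
          refine (Finset.abs_sum_le_sum_abs _ _).trans (Finset.sum_le_sum fun s hs => ?_)
          rw [abs_mul, abs_of_nonneg (hα s)]
          exact mul_le_mul_of_nonneg_left
            (hT' s ((le_of_max_le_right ht).trans (Finset.mem_Ico.1 hs).1)) (hα s)
      _ = (∑ s ∈ Finset.Ico t n, α s) * (ε / 2) := by rw [Finset.sum_mul]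
      -- The cap on the total step size of a window turns a uniform error into a window error;
      -- convergence of the full weighted sums would not survive such an approximation.
      _ ≤ 1 * (ε / 2) := mul_le_mul_of_nonneg_right h1 (half_pos hε).le
      _ = ε / 2 := one_mul _
  have e3 : ∑ s ∈ Finset.Ico t n, α s * b s =
      ∑ s ∈ Finset.Ico t n, α s * b' s + ∑ s ∈ Finset.Ico t n, α s * (b s - b' s) := by
    rw [← Finset.sum_add_distrib]
    exact Finset.sum_congr rfl fun s _ => by ring
  rw [e3]
  exact (abs_add_le _ _).trans (by linarith)

/-- A window sum is a difference of two late partial sums, so the Cauchy property suffices. -/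
theorem of_tendsto_sum {c : ℝ}
    (h : Tendsto (fun n => ∑ s ∈ Finset.range n, α s * b s) atTop (𝓝 c)) :
    WindowNegligible α b := by
  intro ε hε
  obtain ⟨T, hT⟩ := Metric.cauchySeq_iff.1 h.cauchySeq ε hε
  refine ⟨T, fun t ht n hn _ => ?_⟩
  have := hT n (ht.trans hn) t ht
  rw [Real.dist_eq, ← Finset.sum_Ico_eq_sub _ hn] at this
  exact this.le

theorem zero : WindowNegligible α (fun _ => 0) :=
  of_tendsto_sum (c := 0) (by simp)

theorem congr' (hα : ∀ t, 0 ≤ α t) (hb' : WindowNegligible α b')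
    (h : ∀ᶠ s in atTop, b s = b' s) : WindowNegligible α b :=
  of_approx hα fun ε hε => ⟨b', hb', h.mono fun s hs => by simpa [hs] using hε.le⟩

theorem of_tendsto_zero (hα : ∀ t, 0 ≤ α t) (h : Tendsto b atTop (𝓝 0)) :
    WindowNegligible α b :=
  of_approx hα fun ε hε => ⟨_, zero, by
    filter_upwards [(Metric.tendsto_nhds.1 h) ε hε] with s hs
    simpa [Real.dist_eq] using hs.le⟩

end WindowNegligible

/-- If the step sizes tend to `0` and are not summable, every late time ends a window whose total
step size is between `δ` and `2 δ`. -/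
theorem eventually_exists_window {α : ℕ → ℝ} (hα0 : ∀ t, 0 ≤ α t) (hα1 : ¬ Summable α)
    (hlim : Tendsto α atTop (𝓝 0)) {δ : ℝ} (hδ : 0 < δ) (T : ℕ) :
    ∀ᶠ n in atTop, ∃ t, T ≤ t ∧ t ≤ n ∧
      δ ≤ ∑ s ∈ Finset.Ico t n, α s ∧ ∑ s ∈ Finset.Ico t n, α s ≤ 2 * δ := by
  obtain ⟨T₁, hT₁⟩ := eventually_atTop.1 (hlim.eventually (ge_mem_nhds hδ))
  set T₂ := max T T₁ with hT₂
  have hdiv := (not_summable_iff_tendsto_nat_atTop_of_nonneg hα0).1 hα1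
  filter_upwards [hdiv.eventually_ge_atTop (δ + ∑ s ∈ Finset.range T₂, α s),
    eventually_ge_atTop T₂] with n hn hn2
  let p : ℕ → Prop := fun t => δ ≤ ∑ s ∈ Finset.Ico t n, α s
  classical
  have hp : p T₂ := by
    change δ ≤ _
    rw [Finset.sum_Ico_eq_sub _ hn2]
    linarith
  -- The window starts at the latest time from which the mass is still at least `δ`. Without its
  -- first step the mass is below `δ`, and that step is at most `δ`, whence `2 * δ`.
  have h1 : p (Nat.findGreatest p n) := Nat.findGreatest_spec hn2 hp
  have h2 : T₂ ≤ Nat.findGreatest p n := Nat.le_findGreatest hn2 hp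
  set t := Nat.findGreatest p n with ht
  have htn : t < n := by
    rcases (Nat.findGreatest_le (P := p) n).lt_or_eq with h | h
    · exact h
    · exfalso
      have h1' : p n := by rw [← h]; exact h1
      simp only [p, Finset.Ico_self, Finset.sum_empty] at h1'
      linarith
  refine ⟨t, (le_max_left _ _).trans h2, htn.le, h1, ?_⟩
  have h3 : ¬ p (t + 1) := Nat.findGreatest_is_greatest (Nat.lt_succ_self _) htn
  have h4 : ∑ s ∈ Finset.Ico (t + 1) n, α s < δ := not_le.1 h3
  rw [Finset.sum_eq_sum_Ico_succ_bot htn]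
  have := hT₁ t ((le_max_right _ _).trans h2)
  linarith

/-- One window of a stochastic approximation scheme, compared with one Euler step. -/
theorem norm_window_sub_euler_le {X E : Type*} [Fintype X] [DecidableEq X] [NormedAddCommGroup E]
    [NormedSpace ℝ E] {α : ℕ → ℝ} (hα0 : ∀ t, 0 ≤ α t) (z : ℕ → X) (d : X → ℝ) (F : X → E → E)
    {L B ε : ℝ} (hL0 : 0 ≤ L) (hF : ∀ x v w, ‖F x v - F x w‖ ≤ L * ‖v - w‖) (v : ℕ → E)
    (hv : ∀ t, v (t + 1) = v t + α t • F (z t) (v t)) {t n : ℕ} (htn : t ≤ n)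
    (hB : ∀ s ≥ t, ∀ x, ‖F x (v s)‖ ≤ B)
    (hε : ∀ x, |∑ s ∈ Finset.Ico t n, α s * ((if z s = x then 1 else 0) - d x)| ≤ ε) :
    ‖v n - (v t + (∑ s ∈ Finset.Ico t n, α s) • ∑ x, d x • F x (v t))‖ ≤
      L * B * (∑ s ∈ Finset.Ico t n, α s) ^ 2 + Fintype.card X * (ε * B) := by
  have hB0 : 0 ≤ B := (norm_nonneg _).trans (hB t le_rfl (z t))
  have hsum : ∀ m, t ≤ m → v m = v t + ∑ s ∈ Finset.Ico t m, α s • F (z s) (v s) := by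
    intro m hm
    induction m, hm using Nat.le_induction with
    | base => simp
    | succ m hm ih => rw [Finset.sum_Ico_succ_top hm, ← add_assoc, ← ih, hv]
  set θ := ∑ s ∈ Finset.Ico t n, α s with hθ
  have hdist : ∀ s ∈ Finset.Ico t n, ‖v s - v t‖ ≤ B * θ := by
    intro s hs
    have hs' := Finset.mem_Ico.1 hs
    rw [hsum s hs'.1, add_sub_cancel_left]
    calc ‖∑ k ∈ Finset.Ico t s, α k • F (z k) (v k)‖ ≤ ∑ k ∈ Finset.Ico t s, B * α k := by
          refine (norm_sum_le _ _).trans (Finset.sum_le_sum fun k hk => ?_)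
          rw [norm_smul, Real.norm_of_nonneg (hα0 k), mul_comm]
          exact mul_le_mul_of_nonneg_right (hB k (Finset.mem_Ico.1 hk).1 _) (hα0 k)
      _ ≤ ∑ k ∈ Finset.Ico t n, B * α k :=
          Finset.sum_le_sum_of_subset_of_nonneg (Finset.Ico_subset_Ico le_rfl hs'.2.le)
            fun k _ _ => mul_nonneg hB0 (hα0 k)
      _ = B * θ := by rw [Finset.mul_sum]
  -- Two errors: freezing the argument of `F` at `v t`, quadratic in `θ` because `v` moves by at
  -- most `B * θ`, and replacing the weighted occupation of the window by `d`.
  have e1 : v n - (v t + θ • ∑ x, d x • F x (v t)) =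
      ∑ s ∈ Finset.Ico t n, α s • (F (z s) (v s) - F (z s) (v t)) +
      ∑ x, (∑ s ∈ Finset.Ico t n, α s * ((if z s = x then 1 else 0) - d x)) • F x (v t) := by
    have e2 : ∑ x, (∑ s ∈ Finset.Ico t n, α s * ((if z s = x then 1 else 0) - d x)) • F x (v t) =
        ∑ s ∈ Finset.Ico t n, α s • F (z s) (v t) - θ • ∑ x, d x • F x (v t) := by
      simp only [Finset.sum_smul, mul_sub, sub_smul, Finset.sum_sub_distrib]
      rw [Finset.sum_comm]
      congr 1
      · refine Finset.sum_congr rfl fun s _ => ?_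
        simp
      · rw [Finset.smul_sum]
        refine Finset.sum_congr rfl fun x _ => ?_
        rw [← Finset.sum_smul, ← Finset.sum_mul, mul_smul]
    rw [e2, hsum n htn]
    simp only [smul_sub, Finset.sum_sub_distrib]
    abel
  rw [e1]
  refine (norm_add_le _ _).trans (add_le_add ?_ ?_)
  · calc _ ≤ ∑ s ∈ Finset.Ico t n, α s * (L * (B * θ)) := by
          refine (norm_sum_le _ _).trans (Finset.sum_le_sum fun s hs => ?_)
          rw [norm_smul, Real.norm_of_nonneg (hα0 s)]
          exact mul_le_mul_of_nonneg_left ((hF _ _ _).trans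
            (mul_le_mul_of_nonneg_left (hdist s hs) hL0)) (hα0 s)
      _ = L * B * θ ^ 2 := by rw [← Finset.sum_mul, ← hθ]; ring
  · calc _ ≤ ∑ _x : X, ε * B := by
          refine (norm_sum_le _ _).trans (Finset.sum_le_sum fun x _ => ?_)
          rw [norm_smul, Real.norm_eq_abs]
          exact mul_le_mul (hε x) (hB t le_rfl x) (norm_nonneg _) ((abs_nonneg _).trans (hε x))
      _ = _ := by simp

/-- Convergence of stochastic approximation along a path whose occupation averages out to `d`: it
suffices that small Euler steps of the mean field contract towards the limit. -/
theorem tendsto_of_windowNegligible {X E : Type*} [Fintype X] [DecidableEq X]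
    [NormedAddCommGroup E] [NormedSpace ℝ E] {α : ℕ → ℝ} (hα0 : ∀ t, 0 ≤ α t)
    (hα1 : ¬ Summable α) (hlim : Tendsto α atTop (𝓝 0)) (z : ℕ → X) (d : X → ℝ)
    (hd : ∀ x, WindowNegligible α (fun s => (if z s = x then 1 else 0) - d x)) (F : X → E → E)
    {L B c : ℝ} (hL0 : 0 ≤ L) (hF : ∀ x v w, ‖F x v - F x w‖ ≤ L * ‖v - w‖) (v : ℕ → E)
    (hv : ∀ t, v (t + 1) = v t + α t • F (z t) (v t))
    (hB : ∀ᶠ t in atTop, ∀ x, ‖F x (v t)‖ ≤ B) (hvB : ∀ᶠ t in atTop, ‖v t‖ ≤ B)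
    (hc : 0 < c) (w : E)
    (hw : ∀ᶠ t in atTop, ∀ δ, 0 ≤ δ → δ ≤ 1 →
      ‖v t + δ • ∑ x, d x • F x (v t) - w‖ ≤ (1 - c * δ) * ‖v t - w‖) :
    Tendsto v atTop (𝓝 w) := by
  have hB0 : 0 ≤ B := by
    obtain ⟨t, ht⟩ := hvB.exists
    exact (norm_nonneg _).trans ht
  set a : ℕ → ℝ := fun t => ‖v t - w‖ with ha
  have ha0 : ∀ t, 0 ≤ a t := fun t => norm_nonneg _
  have haB : ∀ᶠ t in atTop, a t ≤ B + ‖w‖ := hvB.mono fun t ht =>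
    (norm_sub_le _ _).trans (by linarith)
  have hbdd : IsBoundedUnder (· ≤ ·) atTop a := ⟨_, haB⟩
  have hcob : IsCoboundedUnder (· ≤ ·) atTop a :=
    (isBoundedUnder_of ⟨0, ha0⟩ : IsBoundedUnder (· ≥ ·) atTop a).isCoboundedUnder_le
  set ℓ := limsup a atTop with hℓ
  have hℓ0 : 0 ≤ ℓ := le_limsup_of_frequently_le (Frequently.of_forall ha0) hbdd
  -- The error of one window is `K * δ ^ 2`: the `4` comes from `θ ≤ 2 * δ`, the second term from
  -- demanding occupation accuracy `δ ^ 2`.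
  set K := 4 * (L * B) + Fintype.card X * B with hK
  have hK0 : 0 ≤ K := by positivity
  have key : ∀ δ, 0 < δ → δ ≤ 1 / 2 → c * δ ≤ 1 / 2 → c * ℓ ≤ K * δ := by
    intro δ hδ hδ1 hcδ
    -- Every late `n` ends a window that starts late, so the bound for one window passes to the
    -- limsup. Cancelling `ℓ` leaves a loss of order `δ` against an error of order `δ ^ 2`, and `δ →
    -- 0` forces `ℓ = 0`.
    have step : ∀ η > 0, ℓ ≤ (1 - c * δ) * (ℓ + η) + K * δ ^ 2 := by
      intro η hη
      have h1 : ∀ᶠ t in atTop, a t < ℓ + η :=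
        eventually_lt_of_limsup_lt (by linarith) hbdd
      have h2 : ∀ᶠ t in atTop, ∀ x, ∀ n ≥ t, ∑ s ∈ Finset.Ico t n, α s ≤ 1 →
          |∑ s ∈ Finset.Ico t n, α s * ((if z s = x then 1 else 0) - d x)| ≤ δ ^ 2 := by
        rw [eventually_all]
        intro x
        obtain ⟨T, hT⟩ := hd x (δ ^ 2) (by positivity)
        exact eventually_atTop.2 ⟨T, hT⟩
      obtain ⟨T, hT⟩ := eventually_atTop.1 (h1.and (h2.and (hB.and hw)))
      refine limsup_le_of_le hcob ?_
      filter_upwards [eventually_exists_window hα0 hα1 hlim hδ T] with n ⟨t, htT, htn, hθ1, hθ2⟩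
      set θ := ∑ s ∈ Finset.Ico t n, α s with hθ
      obtain ⟨g1, g2, g3, g4⟩ := hT t htT
      have hE := norm_window_sub_euler_le hα0 z d F hL0 hF v hv htn
        (fun s hs => (hT s (htT.trans hs)).2.2.1) (fun x => g2 x n htn (by linarith))
      rw [← hθ] at hE
      have hC := g4 θ (by linarith) (by linarith)
      have hsq : θ ^ 2 ≤ 4 * δ ^ 2 := by nlinarith
      have hLB : L * B * θ ^ 2 ≤ L * B * (4 * δ ^ 2) :=
        mul_le_mul_of_nonneg_left hsq (by positivity)
      have tri : a n ≤ ‖v n - (v t + θ • ∑ x, d x • F x (v t))‖ +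
          ‖v t + θ • ∑ x, d x • F x (v t) - w‖ := by
        refine le_trans (le_of_eq ?_) (norm_add_le _ _)
        simp [ha]
      have hcθ : (1 - c * θ) * a t ≤ (1 - c * δ) * (ℓ + η) := by
        have : c * δ ≤ c * θ := mul_le_mul_of_nonneg_left hθ1 hc.le
        calc (1 - c * θ) * a t ≤ (1 - c * δ) * a t :=
              mul_le_mul_of_nonneg_right (by linarith) (ha0 t)
          _ ≤ _ := mul_le_mul_of_nonneg_left g1.le (by linarith)
      have : K * δ ^ 2 = L * B * (4 * δ ^ 2) + Fintype.card X * (δ ^ 2 * B) := by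
        rw [hK]; ring
      have hC' : ‖v t + θ • ∑ x, d x • F x (v t) - w‖ ≤ (1 - c * θ) * a t := hC
      linarith
    have lim : ℓ ≤ (1 - c * δ) * ℓ + K * δ ^ 2 := by
      refine le_of_forall_pos_le_add fun η hη => (step η hη).trans ?_
      have : (1 - c * δ) * η ≤ η := by
        have : 0 ≤ c * δ * η := by positivity
        linarith
      linarith
    have : δ * (c * ℓ) ≤ δ * (K * δ) := by linarith
    exact le_of_mul_le_mul_left this hδ
  have hcℓ : c * ℓ ≤ 0 := by
    have h1 : Tendsto (fun δ : ℝ => K * δ) (𝓝[>] 0) (𝓝 0) := by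
      have : Tendsto (fun δ : ℝ => K * δ) (𝓝 0) (𝓝 (K * 0)) := tendsto_id.const_mul K
      rw [mul_zero] at this
      exact this.mono_left nhdsWithin_le_nhds
    refine ge_of_tendsto h1 ?_
    have hm : (0 : ℝ) < min (1 / 2) (1 / (2 * c)) := by positivity
    filter_upwards [Ioc_mem_nhdsGT hm] with δ hδ
    refine key δ hδ.1 (hδ.2.trans (min_le_left _ _)) ?_
    have h2 := hδ.2.trans (min_le_right _ _)
    rw [le_div_iff₀ (by positivity)] at h2
    linarith
  have hℓ' : ℓ ≤ 0 := nonpos_of_mul_nonpos_right hcℓ hc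
  rw [tendsto_iff_norm_sub_tendsto_zero]
  exact tendsto_of_le_liminf_of_limsup_le
    (le_liminf_of_le hbdd.isCoboundedUnder_ge (Eventually.of_forall ha0)) hℓ' hbdd
    (isBoundedUnder_of ⟨0, ha0⟩)

/-! ### Harmonic functions and Poisson's equation for stochastic matrices -/

section Stochastic

open Matrix

variable {X : Type*} [Fintype X] [DecidableEq X] {P : Matrix X X ℝ}

theorem Matrix.mulVec_le_of_mem_rowStochastic (hP : P ∈ rowStochastic ℝ X) {f : X → ℝ} {C : ℝ}
    (hf : ∀ y, f y ≤ C) (x : X) : (P *ᵥ f) x ≤ C := by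
  calc (P *ᵥ f) x = ∑ y, P x y * f y := rfl
    _ ≤ ∑ y, P x y * C :=
        Finset.sum_le_sum fun y _ => mul_le_mul_of_nonneg_left (hf y) (hP.1 x y)
    _ = C := by rw [← Finset.sum_mul, sum_row_of_mem_rowStochastic hP, one_mul]

theorem Matrix.abs_mulVec_le_of_mem_rowStochastic (hP : P ∈ rowStochastic ℝ X) {f : X → ℝ} {C : ℝ}
    (hf : ∀ y, |f y| ≤ C) (x : X) : |(P *ᵥ f) x| ≤ C := by
  refine abs_le'.2 ⟨mulVec_le_of_mem_rowStochastic hP (fun y => (abs_le'.1 (hf y)).1) x, ?_⟩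
  have := mulVec_le_of_mem_rowStochastic hP (f := -f) (fun y => (abs_le'.1 (hf y)).2) x
  rwa [mulVec_neg] at this

theorem Matrix.pow_mulVec_eq_of_harmonic {h : X → ℝ} (hh : P *ᵥ h = h) (n : ℕ) :
    (P ^ n) *ᵥ h = h := by
  induction n with
  | zero => simp
  | succ n ih => rw [pow_succ, ← mulVec_mulVec, hh, ih]

/-- Summing `g = h + (u - P u)` with `h` harmonic along the powers of `P`. -/
theorem Matrix.sum_pow_mulVec_eq {g h u : X → ℝ} (hh : P *ᵥ h = h) (hg : g = h + (u - P *ᵥ u))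
    (n : ℕ) : ∑ k ∈ Finset.range n, (P ^ k) *ᵥ g = (n : ℝ) • h + (u - (P ^ n) *ᵥ u) := by
  induction n with
  | zero => simp
  | succ n ih =>
    rw [Finset.sum_range_succ, ih, hg, mulVec_add, mulVec_sub, pow_mulVec_eq_of_harmonic hh,
      mulVec_mulVec, ← pow_succ, Nat.cast_succ, add_smul, one_smul]
    abel

/-- Poisson's equation for a finite Markov chain: every function is the sum of a harmonic one and
of a coboundary. -/
theorem Matrix.exists_harmonic_add_coboundary (hP : P ∈ rowStochastic ℝ X) (g : X → ℝ) :
    ∃ h u : X → ℝ, P *ᵥ h = h ∧ g = h + (u - P *ᵥ u) := by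
  let Q : (X → ℝ) →ₗ[ℝ] (X → ℝ) := LinearMap.id - P.mulVecLin
  have hQ : ∀ u, Q u = u - P *ᵥ u := fun u => rfl
  have hdisj : Disjoint (LinearMap.ker Q) (LinearMap.range Q) := by
    rw [Submodule.disjoint_def]
    rintro x hx ⟨u, rfl⟩
    have hh : P *ᵥ Q u = Q u := (sub_eq_zero.1 (by rw [← hQ]; exact hx)).symm
    ext y
    by_contra hne
    -- A harmonic coboundary vanishes: `n • Q u = u - P ^ n u` stays bounded. Hence kernel and range
    -- of `1 - P` are disjoint, and rank-nullity makes them span.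
    have hsum : ∀ n : ℕ, (n : ℝ) * |Q u y| ≤ 2 * ‖u‖ := by
      intro n
      have hz := sum_pow_mulVec_eq (g := 0) (h := Q u) (u := -u) hh
        (by rw [mulVec_neg, hQ]; abel) n
      have hz' := congrFun hz y
      simp only [mulVec_zero, Finset.sum_const_zero, Pi.zero_apply, Pi.add_apply, Pi.smul_apply,
        smul_eq_mul, Pi.sub_apply, Pi.neg_apply, mulVec_neg] at hz'
      have e1 : |u y| ≤ ‖u‖ := norm_le_pi_norm u y
      have e2 : |((P ^ n) *ᵥ u) y| ≤ ‖u‖ :=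
        abs_mulVec_le_of_mem_rowStochastic (pow_mem hP n) (fun y => norm_le_pi_norm u y) y
      have e3 : (n : ℝ) * Q u y = u y - ((P ^ n) *ᵥ u) y := by linarith
      rw [← abs_of_nonneg (Nat.cast_nonneg (α := ℝ) n), ← abs_mul, e3]
      exact (abs_sub _ _).trans (by linarith)
    obtain ⟨n, hn⟩ := exists_nat_gt (2 * ‖u‖ / |Q u y|)
    rw [div_lt_iff₀ (abs_pos.2 hne)] at hn
    exact absurd (hsum n) (not_le.2 hn)
  have htop := Submodule.eq_top_of_disjoint (LinearMap.ker Q) (LinearMap.range Q)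
    (by rw [add_comm, LinearMap.finrank_range_add_finrank_ker]) hdisj
  obtain ⟨h, hh, w, ⟨u, rfl⟩, hg⟩ := Submodule.mem_sup.1 (htop ▸ Submodule.mem_top (x := g))
  exact ⟨h, u, (sub_eq_zero.1 hh).symm, hg.symm⟩

/-- If the powers of `P` converge, they converge to the harmonic part. -/
theorem Matrix.tendsto_pow_mulVec_harmonic {g h u : X → ℝ}
    (hh : P *ᵥ h = h) (hg : g = h + (u - P *ᵥ u))
    (hlim : ∀ x y, ∃ p, Tendsto (fun n => (P ^ n) x y) atTop (𝓝 p)) (x : X) :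
    Tendsto (fun n => ((P ^ n) *ᵥ g) x) atTop (𝓝 (h x)) := by
  choose p hp using hlim
  -- Since `P ^ n u` converges, the correction `P ^ n u - P ^ (n + 1) u` to `h` tends to zero.
  have h1 : Tendsto (fun n => ((P ^ n) *ᵥ u) x) atTop (𝓝 (∑ y, p x y * u y)) :=
    tendsto_finsetSum _ fun y _ => (hp x y).mul_const _
  have h2 := (h1.sub ((tendsto_add_atTop_iff_nat 1).2 h1)).const_add (h x)
  rw [sub_self, add_zero] at h2
  refine h2.congr fun n => ?_
  rw [hg, mulVec_add, mulVec_sub, pow_mulVec_eq_of_harmonic hh, mulVec_mulVec, ← pow_succ]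
  rfl

/-- A state whose long-run frequency is not positive when started from itself has no long-run
frequency from anywhere. -/
theorem Matrix.harmonic_nonpos_of_self_nonpos (hP : P ∈ rowStochastic ℝ X) {x : X} {h u : X → ℝ}
    (hh : P *ᵥ h = h) (hg : Pi.single x 1 = h + (u - P *ᵥ u)) (hx : h x ≤ 0) (y : X) :
    h y ≤ 0 := by
  obtain ⟨z, -, hz⟩ := Finset.exists_max_image Finset.univ h ⟨x, Finset.mem_univ x⟩
  refine (hz y (Finset.mem_univ y)).trans ?_
  by_contra! hpos
  -- Maximum principle: from a maximizer `z` only other maximizers are reached, and `x` is none of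
  -- them since `h x ≤ 0 < h z`. With no visits to `x` from `z`, the summed Poisson equation makes
  -- `n * h z` bounded in `n`.
  have hzero : ∀ k, (P ^ k) z x = 0 := by
    intro k
    have hk : P ^ k ∈ rowStochastic ℝ X := pow_mem hP k
    have h1 : ∑ w, (P ^ k) z w * (h z - h w) = 0 := by
      simp only [mul_sub, Finset.sum_sub_distrib]
      rw [← Finset.sum_mul, sum_row_of_mem_rowStochastic hk, one_mul, sub_eq_zero]
      exact (congrFun (pow_mulVec_eq_of_harmonic hh k) z).symm
    have h2 := (Finset.sum_eq_zero_iff_of_nonneg fun w _ =>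
      mul_nonneg (hk.1 z w) (sub_nonneg.2 (hz w (Finset.mem_univ w)))).1 h1 x (Finset.mem_univ x)
    exact (mul_eq_zero.1 h2).resolve_right (by linarith)
  obtain ⟨n, hn⟩ := exists_nat_gt (2 * ‖u‖ / h z)
  rw [div_lt_iff₀ hpos] at hn
  have hz' := congrFun (sum_pow_mulVec_eq hh hg n) z
  have e0 : (∑ k ∈ Finset.range n, (P ^ k) *ᵥ Pi.single x (1 : ℝ)) z = 0 := by
    simp [Finset.sum_apply, hzero]
  rw [e0] at hz'
  simp only [Pi.add_apply, Pi.smul_apply, smul_eq_mul, Pi.sub_apply] at hz'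
  have e1 := abs_le.1 (show |u z| ≤ ‖u‖ from norm_le_pi_norm u z)
  have e2 := abs_le.1 (abs_mulVec_le_of_mem_rowStochastic (pow_mem hP n)
    (fun y => show |u y| ≤ ‖u‖ from norm_le_pi_norm u y) z)
  linarith [e1.1, e2.2]

end Stochastic

/-! ### Martingales along a finite Markov chain -/

section Markov

set_option linter.unusedSectionVars false

open Matrix

variable {X : Type*} [Fintype X] [DecidableEq X] [MeasurableSpace X] [MeasurableSingletonClass X]
  {Ω : Type*} [MeasurableSpace Ω]

/-- `Y` is a Markov chain on a finite state space with transition matrix `P`. -/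
structure IsMarkovChain (μ : Measure Ω) (P : Matrix X X ℝ) (Y : ℕ → Ω → X) : Prop where
  measurable : ∀ t, Measurable (Y t)
  markov : ∀ (n : ℕ) (y : ℕ → X), μ.real {ω | ∀ j ≤ n + 1, Y j ω = y j} =
    μ.real {ω | ∀ j ≤ n, Y j ω = y j} * P (y n) (y (n + 1))

namespace IsMarkovChain

/-- The path of a process up to time `n`. -/
def past (Y : ℕ → Ω → X) (n : ℕ) (ω : Ω) : Fin (n + 1) → X := fun j => Y j ω

/-- Partial sums of the weighted martingale differences `g (Y (t + 1)) - P g (Y t)`. -/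
def mart (P : Matrix X X ℝ) (Y : ℕ → Ω → X) (g : X → ℝ) (c : ℕ → ℝ) (n : ℕ) (ω : Ω) : ℝ :=
  ∑ t ∈ Finset.range n, c t * (g (Y (t + 1) ω) - (P *ᵥ g) (Y t ω))

variable {μ : Measure Ω} [IsProbabilityMeasure μ] {P : Matrix X X ℝ} {Y : ℕ → Ω → X}

theorem measurable_past (hY : IsMarkovChain μ P Y) (n : ℕ) : Measurable (past Y n) :=
  measurable_pi_lambda _ fun _ => hY.measurable _

theorem integrable_comp_of_finite {E : Type*} [Finite E] [MeasurableSpace E]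
    [MeasurableSingletonClass E] {f : Ω → E} (hf : Measurable f) (ψ : E → ℝ) :
    Integrable (fun ω => ψ (f ω)) μ :=
  haveI : IsFiniteMeasure (μ.map f) := inferInstance
  (Integrable.of_finite (f := ψ) (μ := μ.map f)).comp_measurable hf

theorem integral_comp_of_fintype {E : Type*} [Fintype E] [MeasurableSpace E]
    [MeasurableSingletonClass E] {f : Ω → E} (hf : Measurable f) (ψ : E → ℝ) :
    ∫ ω, ψ (f ω) ∂μ = ∑ e, μ.real (f ⁻¹' {e}) * ψ e := by
  rw [← integral_map (f := ψ) hf.aemeasurable (measurable_of_finite ψ).aestronglyMeasurable,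
    integral_fintype Integrable.of_finite]
  refine Finset.sum_congr rfl fun e _ => ?_
  rw [smul_eq_mul, map_measureReal_apply hf (measurableSet_singleton e)]

theorem measureReal_past_succ (hY : IsMarkovChain μ P Y) (n : ℕ) (p : Fin (n + 1) → X) (x : X) :
    μ.real ((fun ω => (past Y n ω, Y (n + 1) ω)) ⁻¹' {(p, x)}) =
      μ.real (past Y n ⁻¹' {p}) * P (p (Fin.last n)) x := by
  -- The value `x` matters only at time `n + 1`; later ones are a default.
  let y : ℕ → X := fun j => if hj : j < n + 1 then p ⟨j, hj⟩ else x
  have hy : ∀ j (hj : j < n + 1), y j = p ⟨j, hj⟩ := fun j hj => dif_pos hj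
  have hx : y (n + 1) = x := dif_neg (lt_irrefl _)
  have hpast : ∀ ω, past Y n ω = p ↔ ∀ j ≤ n, Y j ω = y j := by
    intro ω
    constructor
    · rintro rfl j hj
      rw [hy j (Nat.lt_succ_of_le hj)]
      rfl
    · intro h
      funext j
      rw [past, h j (Nat.le_of_lt_succ j.2), hy j j.2]
  have h1 : (fun ω => (past Y n ω, Y (n + 1) ω)) ⁻¹' {(p, x)} =
      {ω | ∀ j ≤ n + 1, Y j ω = y j} := by
    ext ω
    simp only [Set.mem_preimage, Set.mem_singleton_iff, Prod.mk.injEq, Set.mem_ofPred_eq, hpast]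
    constructor
    · rintro ⟨h, h'⟩ j hj
      rcases Nat.le_succ_iff.1 hj with hj | rfl
      · exact h j hj
      · rw [h', hx]
    · intro h
      exact ⟨fun j hj => h j (hj.trans (Nat.le_succ n)), by rw [h _ le_rfl, hx]⟩
  have h2 : past Y n ⁻¹' {p} = {ω | ∀ j ≤ n, Y j ω = y j} := by
    ext ω
    exact hpast ω
  rw [h1, h2, hY.markov, hy n (Nat.lt_succ_self n), hx]
  rfl

/-- The Markov property, integrated against a function of the past. -/
theorem integral_past_mul (hY : IsMarkovChain μ P Y) (n : ℕ) (φ : (Fin (n + 1) → X) → ℝ)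
    (g : X → ℝ) :
    ∫ ω, φ (past Y n ω) * (g (Y (n + 1) ω) - (P *ᵥ g) (Y n ω)) ∂μ = 0 := by
  have hm := hY.measurable_past n
  have h1 := integral_comp_of_fintype (μ := μ) (hm.prodMk (hY.measurable (n + 1)))
    fun e : (Fin (n + 1) → X) × X => φ e.1 * g e.2
  have h2 := integral_comp_of_fintype (μ := μ) hm fun p => φ p * (P *ᵥ g) (p (Fin.last n))
  have i1 := integrable_comp_of_finite (μ := μ) (hm.prodMk (hY.measurable (n + 1)))
    fun e : (Fin (n + 1) → X) × X => φ e.1 * g e.2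
  have i2 := integrable_comp_of_finite (μ := μ) hm fun p => φ p * (P *ᵥ g) (p (Fin.last n))
  have e : (fun ω => φ (past Y n ω) * (g (Y (n + 1) ω) - (P *ᵥ g) (Y n ω))) = fun ω =>
      φ (past Y n ω) * g (Y (n + 1) ω) - φ (past Y n ω) * (P *ᵥ g) (past Y n ω (Fin.last n)) := by
    funext ω
    simp only [past, Fin.val_last]
    ring
  rw [e, integral_sub i1 i2, sub_eq_zero]
  refine h1.trans (Eq.trans ?_ h2.symm)
  rw [Fintype.sum_prod_type]
  refine Finset.sum_congr rfl fun p _ => ?_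
  simp only [hY.measureReal_past_succ, mulVec, dotProduct, Finset.mul_sum]
  exact Finset.sum_congr rfl fun x _ => by ring

theorem integral_succ (hY : IsMarkovChain μ P Y) (n : ℕ) (g : X → ℝ) :
    ∫ ω, (P *ᵥ g) (Y n ω) ∂μ = ∫ ω, g (Y (n + 1) ω) ∂μ := by
  have h := hY.integral_past_mul n (fun _ => 1) g
  simp only [one_mul] at h
  rw [integral_sub (integrable_comp_of_finite (hY.measurable _) g)
    (integrable_comp_of_finite (hY.measurable _) (P *ᵥ g)), sub_eq_zero] at h
  exact h.symm

/-- The filtration generated by a process. -/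
def pastFiltration (hY : IsMarkovChain μ P Y) : Filtration ℕ (inferInstance : MeasurableSpace Ω)
    where
  seq n := MeasurableSpace.comap (past Y n) inferInstance
  mono' := by
    intro n m hnm
    have e : past Y n = (fun p : Fin (m + 1) → X => fun j => p (Fin.castLE (by omega) j)) ∘
      past Y m := rfl
    change MeasurableSpace.comap (past Y n) _ ≤ _
    rw [e, ← MeasurableSpace.comap_comp]
    exact MeasurableSpace.comap_mono (measurable_of_finite _).comap_le
  le' n := (hY.measurable_past n).comap_le

theorem mart_eq_past (g : X → ℝ) (c : ℕ → ℝ) (n : ℕ) :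
    ∃ φ : (Fin (n + 1) → X) → ℝ, ∀ ω, mart P Y g c n ω = φ (past Y n ω) :=
  ⟨fun p => ∑ t : Fin n, c t * (g (p t.succ) - (P *ᵥ g) (p t.castSucc)), fun ω => by
    rw [mart, Finset.sum_range]
    rfl⟩

theorem integrable_mart (hY : IsMarkovChain μ P Y) (g : X → ℝ) (c : ℕ → ℝ) (n : ℕ) :
    Integrable (mart P Y g c n) μ := by
  obtain ⟨φ, hφ⟩ := mart_eq_past (P := P) (Y := Y) g c n
  rw [show mart P Y g c n = _ from funext hφ]
  exact integrable_comp_of_finite (hY.measurable_past n) φ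

theorem martingale_mart (hY : IsMarkovChain μ P Y) (g : X → ℝ) (c : ℕ → ℝ) :
    Martingale (mart P Y g c) hY.pastFiltration μ := by
  refine martingale_of_setIntegral_eq_succ (fun n => ?_) (hY.integrable_mart g c) fun n s hs => ?_
  · obtain ⟨φ, hφ⟩ := mart_eq_past (P := P) (Y := Y) g c n
    rw [show mart P Y g c n = φ ∘ past Y n from funext hφ]
    exact ((measurable_of_finite φ).comp (comap_measurable _)).stronglyMeasurable
  · have hs' := hY.pastFiltration.le n s hs
    obtain ⟨B, -, rfl⟩ := hs
    rw [← sub_eq_zero, ← integral_sub (hY.integrable_mart g c _).integrableOn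
      (hY.integrable_mart g c _).integrableOn, ← integral_indicator hs', ← neg_eq_zero,
      ← integral_neg]
    -- An event of the filtration is a condition `B` on the finite past, so this is the Markov
    -- property tested against the indicator of `B` times `c n`.
    refine Eq.trans (integral_congr_ae (Eventually.of_forall fun ω => ?_))
      (hY.integral_past_mul n (B.indicator fun _ => c n) g)
    by_cases hω : past Y n ω ∈ B
    · simp [Set.indicator, hω, mart, Finset.sum_range_succ]
    · simp [Set.indicator, hω]

theorem abs_diff_le {P : Matrix X X ℝ} (hP : P ∈ rowStochastic ℝ X) (g : X → ℝ) (x y : X) :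
    |g x - (P *ᵥ g) y| ≤ 2 * ‖g‖ := by
  have h1 : |g x| ≤ ‖g‖ := norm_le_pi_norm g x
  have h2 := abs_mulVec_le_of_mem_rowStochastic hP (f := g) (fun z => norm_le_pi_norm g z) y
  exact (abs_sub _ _).trans (by linarith)

/-- Martingale increments are orthogonal: the cross term is a function of the past times a
difference of conditional mean zero. -/
theorem integral_mart_sq_le (hY : IsMarkovChain μ P Y) (hP : P ∈ rowStochastic ℝ X) (g : X → ℝ)
    (c : ℕ → ℝ) (n : ℕ) :
    ∫ ω, mart P Y g c n ω ^ 2 ∂μ ≤ ∑ t ∈ Finset.range n, c t ^ 2 * (2 * ‖g‖) ^ 2 := by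
  induction n with
  | zero => simp [mart]
  | succ n ih =>
    obtain ⟨φ, hφ⟩ := mart_eq_past (P := P) (Y := Y) g c n
    set ξ : Ω → ℝ := fun ω => g (Y (n + 1) ω) - (P *ᵥ g) (Y n ω) with hξ
    have hpair : Measurable fun ω => (past Y n ω, Y (n + 1) ω) :=
      (hY.measurable_past n).prodMk (hY.measurable (n + 1))
    have e : (fun ω => mart P Y g c (n + 1) ω ^ 2) = fun ω =>
        mart P Y g c n ω ^ 2 + (2 * c n * φ (past Y n ω) * ξ ω + c n ^ 2 * ξ ω ^ 2) := by
      funext ω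
      rw [← hφ, hξ, mart, Finset.sum_range_succ, ← mart]
      ring
    have i1 : Integrable (fun ω => mart P Y g c n ω ^ 2) μ := by
      simp only [hφ]
      exact integrable_comp_of_finite (hY.measurable_past n) fun p => φ p ^ 2
    have i2 : Integrable (fun ω => 2 * c n * φ (past Y n ω) * ξ ω) μ :=
      integrable_comp_of_finite hpair fun e : (Fin (n + 1) → X) × X =>
        2 * c n * φ e.1 * (g e.2 - (P *ᵥ g) (e.1 (Fin.last n)))
    have i3 : Integrable (fun ω => c n ^ 2 * ξ ω ^ 2) μ :=
      integrable_comp_of_finite hpair fun e : (Fin (n + 1) → X) × X =>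
        c n ^ 2 * (g e.2 - (P *ᵥ g) (e.1 (Fin.last n))) ^ 2
    have i4 : Integrable (fun ω => 2 * c n * φ (past Y n ω) * ξ ω + c n ^ 2 * ξ ω ^ 2) μ :=
      i2.add i3
    rw [e, integral_add i1 i4, integral_add i2 i3,
      hY.integral_past_mul n (fun p => 2 * c n * φ p) g, zero_add, Finset.sum_range_succ]
    refine add_le_add ih ?_
    calc ∫ ω, c n ^ 2 * ξ ω ^ 2 ∂μ ≤ ∫ _ω, c n ^ 2 * (2 * ‖g‖) ^ 2 ∂μ := by
          refine integral_mono i3 (integrable_const _) fun ω => ?_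
          exact mul_le_mul_of_nonneg_left
            (sq_le_sq' (abs_le.1 (abs_diff_le hP g _ _)).1 (abs_le.1 (abs_diff_le hP g _ _)).2)
            (sq_nonneg _)
      _ = _ := by simp

/-- Doob's convergence theorem for martingales bounded in `L¹`. -/
theorem ae_tendsto_mart_of_integral_abs_le (hY : IsMarkovChain μ P Y) (g : X → ℝ) (c : ℕ → ℝ)
    {R : ℝ} (hR : ∀ n, ∫ ω, |mart P Y g c n ω| ∂μ ≤ R) :
    ∀ᵐ ω ∂μ, ∃ l, Tendsto (fun n => mart P Y g c n ω) atTop (𝓝 l) := by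
  refine (hY.martingale_mart g c).submartingale.exists_ae_tendsto_of_bdd (R := R.toNNReal)
    fun n => ?_
  rw [eLpNorm_one_eq_lintegral_enorm,
    ← ofReal_integral_norm_eq_lintegral_enorm (hY.integrable_mart g c n)]
  exact ENNReal.ofReal_le_ofReal (hR n)

theorem ae_tendsto_mart (hY : IsMarkovChain μ P Y) (hP : P ∈ rowStochastic ℝ X) (g : X → ℝ)
    {c : ℕ → ℝ} (hc : Summable fun t => c t ^ 2) :
    ∀ᵐ ω ∂μ, ∃ l, Tendsto (fun n => mart P Y g c n ω) atTop (𝓝 l) := by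
  refine hY.ae_tendsto_mart_of_integral_abs_le g c
    (R := 1 + (∑' t, c t ^ 2) * (2 * ‖g‖) ^ 2) fun n => ?_
  obtain ⟨φ, hφ⟩ := mart_eq_past (P := P) (Y := Y) g c n
  have i1 : Integrable (fun ω => mart P Y g c n ω ^ 2) μ := by
    simp only [hφ]
    exact integrable_comp_of_finite (hY.measurable_past n) fun p => φ p ^ 2
  calc ∫ ω, |mart P Y g c n ω| ∂μ ≤ ∫ ω, (1 + mart P Y g c n ω ^ 2) ∂μ := by
        refine integral_mono (hY.integrable_mart g c n).abs ((integrable_const _).add i1)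
          fun ω => ?_
        have := sq_abs (mart P Y g c n ω)
        change |mart P Y g c n ω| ≤ 1 + mart P Y g c n ω ^ 2
        nlinarith [sq_nonneg (|mart P Y g c n ω| - 1)]
    _ = 1 + ∫ ω, mart P Y g c n ω ^ 2 ∂μ := by
        rw [integral_add (integrable_const _) i1]
        simp
    _ ≤ 1 + (∑' t, c t ^ 2) * (2 * ‖g‖) ^ 2 := by
        refine add_le_add le_rfl ((hY.integral_mart_sq_le hP g c n).trans ?_)
        rw [← Finset.sum_mul]
        exact mul_le_mul_of_nonneg_right (hc.sum_le_tsum _ fun t _ => sq_nonneg _) (sq_nonneg _)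

/-- Harmonic functions converge along the chain. -/
theorem ae_tendsto_harmonic (hY : IsMarkovChain μ P Y) {h : X → ℝ} (hh : P *ᵥ h = h) :
    ∀ᵐ ω ∂μ, ∃ l, Tendsto (fun n => h (Y n ω)) atTop (𝓝 l) := by
  -- With unit weights and `P h = h` the martingale telescopes, so it is bounded although the
  -- weights are not square summable.
  have e : ∀ n ω, mart P Y h (fun _ => 1) n ω = h (Y n ω) - h (Y 0 ω) := by
    intro n ω
    simp only [mart, hh, one_mul]
    exact Finset.sum_range_sub (fun t => h (Y t ω)) n
  have hb : ∀ n ω, |mart P Y h (fun _ => 1) n ω| ≤ 2 * ‖h‖ := by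
    intro n ω
    have h1 : |h (Y n ω)| ≤ ‖h‖ := norm_le_pi_norm h _
    have h2 : |h (Y 0 ω)| ≤ ‖h‖ := norm_le_pi_norm h _
    rw [e]
    exact (abs_sub _ _).trans (by linarith)
  have := hY.ae_tendsto_mart_of_integral_abs_le h (fun _ => 1) (R := 2 * ‖h‖) fun n => by
    calc ∫ ω, |mart P Y h (fun _ => 1) n ω| ∂μ ≤ ∫ _ω, 2 * ‖h‖ ∂μ :=
          integral_mono (hY.integrable_mart _ _ n).abs (integrable_const _) (hb n)
      _ = 2 * ‖h‖ := by simp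
  filter_upwards [this] with ω ⟨l, hl⟩
  refine ⟨l + h (Y 0 ω), (hl.add_const _).congr fun n => ?_⟩
  rw [e]
  ring

/-- A state without long-run frequency is left for ever. -/
theorem ae_eventually_ne (hY : IsMarkovChain μ P Y) (hP : P ∈ rowStochastic ℝ X) {x : X}
    {h u : X → ℝ} (hh : P *ᵥ h = h) (hg : Pi.single x 1 = h + (u - P *ᵥ u)) (hx : h x ≤ 0) :
    ∀ᵐ ω ∂μ, ∀ᶠ t in atTop, Y t ω ≠ x := by
  have hh0 := harmonic_nonpos_of_self_nonpos hP hh hg hx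
  have hmeas : ∀ t, MeasurableSet {ω | Y t ω = x} := fun t =>
    hY.measurable t (measurableSet_singleton x)
  -- As `h ≤ 0` everywhere, the indicator of `x` is at most `u - P u`, whose expectations telescope.
  -- The expected number of visits is then at most `2 * ‖u‖`, and Borel–Cantelli applies.
  have hle : ∀ t, μ.real {ω | Y t ω = x} ≤ ∫ ω, u (Y t ω) ∂μ - ∫ ω, u (Y (t + 1) ω) ∂μ := by
    intro t
    rw [← hY.integral_succ, ← integral_sub (integrable_comp_of_finite (hY.measurable _) u)
      (integrable_comp_of_finite (hY.measurable _) (P *ᵥ u)), ← integral_indicator_one (hmeas t)]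
    refine integral_mono ((integrable_const 1).indicator (hmeas t))
      ((integrable_comp_of_finite (hY.measurable _) u).sub
      (integrable_comp_of_finite (hY.measurable _) (P *ᵥ u))) fun ω => ?_
    have h1 := congrFun hg (Y t ω)
    have h2 := hh0 (Y t ω)
    simp only [Pi.single_apply, Pi.add_apply, Pi.sub_apply] at h1
    simp only [Set.indicator, Set.mem_ofPred_eq, Pi.one_apply]
    linarith
  have hb : ∀ t, |∫ ω, u (Y t ω) ∂μ| ≤ ‖u‖ := fun t => by
    have := norm_integral_le_of_norm_le_const (μ := μ) (f := fun ω => u (Y t ω)) (C := ‖u‖)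
      (Eventually.of_forall fun ω => norm_le_pi_norm u _)
    simpa using this
  have hsum : Summable fun t => μ.real {ω | Y t ω = x} := by
    refine summable_of_sum_range_le (c := 2 * ‖u‖) (fun t => measureReal_nonneg) fun n => ?_
    refine (Finset.sum_le_sum fun t _ => hle t).trans ?_
    rw [Finset.sum_range_sub' (fun t => ∫ ω, u (Y t ω) ∂μ)]
    linarith [(abs_le.1 (hb 0)).2, (abs_le.1 (hb n)).1]
  have hne : ∑' t, μ {ω | Y t ω = x} ≠ ⊤ := by
    rw [← tsum_congr fun t => ofReal_measureReal (μ := μ) (s := {ω | Y t ω = x})]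
    exact hsum.tsum_ofReal_ne_top
  filter_upwards [ae_eventually_notMem hne] with ω hω
  exact hω

end IsMarkovChain

end Markov

/-! ### Weighted occupation of a path -/

/-- Kronecker's lemma for the weights `1 / (s + 1)`. -/
theorem tendsto_average_zero_of_tendsto_sum {b : ℕ → ℝ} {l : ℝ}
    (h : Tendsto (fun n => ∑ s ∈ Finset.range n, 1 / ((s : ℝ) + 1) * b s) atTop (𝓝 l)) :
    Tendsto (fun n : ℕ => (n : ℝ)⁻¹ * ∑ s ∈ Finset.range n, b s) atTop (𝓝 0) := by
  set a : ℕ → ℝ := fun n => ∑ s ∈ Finset.range n, 1 / ((s : ℝ) + 1) * b s with ha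
  -- Abel summation: after division by `n` this is `a n` minus a Cesàro mean of `a`, with equal
  -- limits.
  have e : ∀ n : ℕ, ∑ s ∈ Finset.range n, b s = n * a n - ∑ s ∈ Finset.range n, a s := by
    intro n
    induction n with
    | zero => simp
    | succ n ih =>
      have h1 : a (n + 1) = a n + 1 / ((n : ℝ) + 1) * b n := Finset.sum_range_succ _ _
      have h2 : (n : ℝ) + 1 ≠ 0 := by positivity
      rw [Finset.sum_range_succ, ih, Finset.sum_range_succ, h1]
      push_cast
      field_simp
      ring
  have h2 := h.sub h.cesaro
  rw [sub_self] at h2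
  refine h2.congr' ?_
  filter_upwards [eventually_ge_atTop 1] with n hn
  have h3 : (n : ℝ) ≠ 0 := Nat.cast_ne_zero.2 (by omega)
  rw [e, mul_sub, inv_mul_cancel_left₀ h3]

theorem summable_sq_one_div_add_one : Summable fun t : ℕ => (1 / ((t : ℝ) + 1)) ^ 2 := by
  have h := (summable_nat_add_iff 1).2 (Real.summable_one_div_nat_pow.2 (by norm_num : 1 < 2))
  refine h.congr fun t => ?_
  push_cast
  rw [div_pow, one_pow]

theorem summable_abs_sub_one_div_add_one :
    Summable fun t : ℕ => |1 / (((t + 1 : ℕ) : ℝ) + 1) - 1 / ((t : ℝ) + 1)| := by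
  refine Summable.of_nonneg_of_le (fun t => abs_nonneg _) (fun t => ?_)
    summable_sq_one_div_add_one
  have h1 : (0 : ℝ) < (t : ℝ) + 1 := by positivity
  have e : 1 / (((t + 1 : ℕ) : ℝ) + 1) - 1 / ((t : ℝ) + 1) =
      -(1 / (((t : ℝ) + 1 + 1) * (t + 1))) := by
    push_cast
    field_simp
    ring
  rw [e, abs_neg, abs_of_nonneg (by positivity), div_pow, one_pow]
  exact one_div_le_one_div_of_le (by positivity) (by nlinarith)

section Path

open Matrix

variable {X : Type*} [Fintype X] {P : Matrix X X ℝ}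

/-- Summation by parts: weighted sums of a coboundary along a path converge if the corresponding
martingale does and the weights have bounded variation. -/
theorem exists_tendsto_sum_coboundary {c : ℕ → ℝ} (hc : Tendsto c atTop (𝓝 0))
    (hbv : Summable fun t => |c (t + 1) - c t|) {u : X → ℝ} {y : ℕ → X} {l : ℝ}
    (hl : Tendsto (fun n => ∑ t ∈ Finset.range n, c t * (u (y (t + 1)) - (P *ᵥ u) (y t)))
      atTop (𝓝 l)) :
    ∃ l', Tendsto (fun n => ∑ t ∈ Finset.range n, c t * (u - P *ᵥ u) (y t)) atTop (𝓝 l') := by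
  have hu : ∀ t, |u (y t)| ≤ ‖u‖ := fun t => norm_le_pi_norm u _
  have hsum : Summable fun t => (c (t + 1) - c t) * u (y (t + 1)) := by
    refine Summable.of_norm_bounded (hbv.mul_right ‖u‖) fun t => ?_
    rw [norm_mul]
    exact mul_le_mul_of_nonneg_left (hu _) (abs_nonneg _)
  have hz : Tendsto (fun n => c n * u (y n)) atTop (𝓝 0) := by
    have := hc.abs.mul_const ‖u‖
    rw [abs_zero, zero_mul] at this
    refine squeeze_zero_norm (fun n => ?_) this
    rw [norm_mul]
    exact mul_le_mul_of_nonneg_left (hu _) (abs_nonneg _)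
  -- The sum equals the martingale, plus the boundary term `c 0 * u (y 0) - c n * u (y n)`, plus the
  -- variation sum of `(c (t + 1) - c t) * u (y (t + 1))`.
  refine ⟨_, ((hl.add ((hz.const_sub (c 0 * u (y 0))).add hsum.hasSum.tendsto_sum_nat))).congr
    fun n => ?_⟩
  induction n with
  | zero => simp
  | succ n ih =>
    simp only [Finset.sum_range_succ, Pi.sub_apply] at ih ⊢
    linarith

/-- The deviation `g - d` is the coboundary, whose weighted sums converge, plus `h - d`, which tends
to zero along the path. -/
theorem WindowNegligible.indicator_of_boundedVariation {α : ℕ → ℝ} (hα0 : ∀ t, 0 ≤ α t)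
    (hα : Tendsto α atTop (𝓝 0)) (hbv : Summable fun t => |α (t + 1) - α t|) {g h u : X → ℝ}
    (hg : g = h + (u - P *ᵥ u)) {y : ℕ → X} {l d : ℝ}
    (hl : Tendsto (fun n => ∑ t ∈ Finset.range n, α t * (u (y (t + 1)) - (P *ᵥ u) (y t)))
      atTop (𝓝 l)) (hd : Tendsto (fun t => h (y t)) atTop (𝓝 d)) :
    WindowNegligible α fun s => g (y s) - d := by
  obtain ⟨l', hl'⟩ := exists_tendsto_sum_coboundary hα hbv hl
  refine ((of_tendsto_sum hl').add (of_tendsto_zero hα0 (tendsto_sub_nhds_zero_iff.2 hd))).congr'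
    hα0 (Eventually.of_forall fun s => ?_)
  simp only [hg, Pi.add_apply]
  ring

/-- The same splitting with weights `1 / (t + 1)`: Kronecker's lemma removes the weights from the
coboundary, and Cesàro treats the harmonic part. -/
theorem tendsto_average_of_harmonic {g h u : X → ℝ}
    (hg : g = h + (u - P *ᵥ u)) {y : ℕ → X} {l d : ℝ}
    (hl : Tendsto (fun n => ∑ t ∈ Finset.range n,
      1 / ((t : ℝ) + 1) * (u (y (t + 1)) - (P *ᵥ u) (y t))) atTop (𝓝 l))
    (hd : Tendsto (fun t => h (y t)) atTop (𝓝 d)) :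
    Tendsto (fun n : ℕ => (n : ℝ)⁻¹ * ∑ s ∈ Finset.range n, g (y s)) atTop (𝓝 d) := by
  obtain ⟨l', hl'⟩ := exists_tendsto_sum_coboundary (c := fun t : ℕ => 1 / ((t : ℝ) + 1))
    tendsto_one_div_add_atTop_nhds_zero_nat summable_abs_sub_one_div_add_one hl
  have h1 := hd.cesaro.add (tendsto_average_zero_of_tendsto_sum hl')
  rw [add_zero] at h1
  refine h1.congr fun n => ?_
  rw [← mul_add, ← Finset.sum_add_distrib, hg]
  rfl

/-- Predicting `g (y s)` from `k` steps earlier costs `k` martingale differences, each with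
convergent weighted sums. For large `k` the prediction `P ^ k g` is uniformly close to `h`, which
converges along the path. The variation of `α` plays no role. -/
theorem WindowNegligible.indicator_of_tendsto_pow [DecidableEq X] {α : ℕ → ℝ}
    (hα0 : ∀ t, 0 ≤ α t) {g h : X → ℝ}
    (hpow : ∀ x, Tendsto (fun n => ((P ^ n) *ᵥ g) x) atTop (𝓝 (h x))) {y : ℕ → X} {d : ℝ}
    (hl : ∀ k : ℕ, ∃ l, Tendsto (fun n => ∑ t ∈ Finset.range n, α (t + (k + 1)) *
      (((P ^ k) *ᵥ g) (y (t + 1)) - (P *ᵥ ((P ^ k) *ᵥ g)) (y t))) atTop (𝓝 l))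
    (hd : Tendsto (fun t => h (y t)) atTop (𝓝 d)) :
    WindowNegligible α fun s => g (y s) - d := by
  have lag : ∀ k, WindowNegligible α fun s => g (y s) - ((P ^ k) *ᵥ g) (y (s - k)) := by
    intro k
    induction k with
    | zero =>
      simp only [pow_zero, one_mulVec, Nat.sub_zero, sub_self]
      exact WindowNegligible.zero
    | succ k ih =>
      have hneg : WindowNegligible α fun s =>
          ((P ^ k) *ᵥ g) (y (s - k)) - ((P ^ (k + 1)) *ᵥ g) (y (s - (k + 1))) := by
        obtain ⟨l, hl⟩ := hl k
        -- The constant absorbs the first `k + 1` terms, where the subtractions may truncate; beyond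
        -- them `s = t + (k + 1)` gives the lagged martingale.
        refine WindowNegligible.of_tendsto_sum (c := ∑ s ∈ Finset.range (k + 1), α s *
          (((P ^ k) *ᵥ g) (y (s - k)) - ((P ^ (k + 1)) *ᵥ g) (y (s - (k + 1)))) + l) ?_
        rw [← tendsto_add_atTop_iff_nat (k + 1)]
        refine (hl.const_add _).congr fun n => ?_
        rw [add_comm n, Finset.sum_range_add _ (k + 1) n]
        refine congrArg _ (Finset.sum_congr rfl fun t _ => ?_)
        rw [mulVec_mulVec, ← pow_succ', add_comm (k + 1) t, Nat.add_sub_cancel,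
          show t + (k + 1) - k = t + 1 by omega]
      refine (ih.add hneg).congr' hα0 (Eventually.of_forall fun s => ?_)
      ring
  refine WindowNegligible.of_approx hα0 fun ε hε => ?_
  have hev : ∀ᶠ n in atTop, ∀ x, |((P ^ n) *ᵥ g) x - h x| < ε / 2 :=
    eventually_all.2 fun x => (Metric.tendsto_nhds.1 (hpow x)) (ε / 2) (half_pos hε)
  obtain ⟨k, hk⟩ := hev.exists
  refine ⟨_, lag k, ?_⟩
  have hd' := (tendsto_sub_atTop_nat k).eventually
    ((Metric.tendsto_nhds.1 hd) (ε / 2) (half_pos hε))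
  filter_upwards [hd'] with s hs
  have h1 := hk (y (s - k))
  rw [Real.dist_eq] at hs
  rw [show g (y s) - d - (g (y s) - ((P ^ k) *ᵥ g) (y (s - k))) =
    (((P ^ k) *ᵥ g) (y (s - k)) - h (y (s - k))) + (h (y (s - k)) - d) by ring]
  exact (abs_add_le _ _).trans (by linarith)

end Path

open Matrix in
/-- Almost every path of a finite Markov chain has a limiting occupation distribution, stays in
its support from some time on, and averages out to it along suitable step sizes. -/
theorem IsMarkovChain.ae_exists_occupation {X : Type*} [Fintype X] [DecidableEq X]
    [MeasurableSpace X] [MeasurableSingletonClass X] {Ω : Type*} [MeasurableSpace Ω]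
    {μ : Measure Ω} [IsProbabilityMeasure μ] {P : Matrix X X ℝ} {Y : ℕ → Ω → X}
    (hY : IsMarkovChain μ P Y) (hP : P ∈ rowStochastic ℝ X) {α : ℕ → ℝ} (hα0 : ∀ t, 0 ≤ α t)
    (hα2 : Summable fun t => α t ^ 2) (hα : Tendsto α atTop (𝓝 0))
    (hosc : (Summable fun t => |α (t + 1) - α t|) ∨
      ∀ x y, ∃ p, Tendsto (fun n => (P ^ n) x y) atTop (𝓝 p)) :
    ∀ᵐ ω ∂μ, ∃ d : X → ℝ, (∀ x, 0 ≤ d x) ∧ ∑ x, d x = 1 ∧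
      (∀ x, Tendsto (fun n : ℕ => (n : ℝ)⁻¹ * ∑ t ∈ Finset.range n,
        if Y t ω = x then (1 : ℝ) else 0) atTop (𝓝 (d x))) ∧
      (∀ᶠ t in atTop, 0 < d (Y t ω)) ∧
      ∀ x, WindowNegligible α fun s => (if Y s ω = x then 1 else 0) - d x := by
  choose h u hh hg using fun x : X => exists_harmonic_add_coboundary hP (Pi.single x (1 : ℝ))
  have A1 := ae_all_iff.2 fun x => hY.ae_tendsto_harmonic (hh x)
  -- `A2` serves the visit frequencies, `A3` the step sizes of bounded variation, and `A4` the case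
  -- of convergent powers.
  have A2 := ae_all_iff.2 fun x => hY.ae_tendsto_mart hP (u x) summable_sq_one_div_add_one
  have A3 := ae_all_iff.2 fun x => hY.ae_tendsto_mart hP (u x) hα2
  have A4 := ae_all_iff.2 fun x => ae_all_iff.2 fun k : ℕ =>
    hY.ae_tendsto_mart hP ((P ^ k) *ᵥ Pi.single x 1) ((summable_nat_add_iff (k + 1)).2 hα2)
  have A5 : ∀ᵐ ω ∂μ, ∀ x, h x x ≤ 0 → ∀ᶠ t in atTop, Y t ω ≠ x :=
    ae_all_iff.2 fun x => by
      by_cases hx : h x x ≤ 0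
      · filter_upwards [hY.ae_eventually_ne hP (hh x) (hg x) hx] with ω hω _ using hω
      · exact Eventually.of_forall fun ω hx' => absurd hx' hx
  filter_upwards [A1, A2, A3, A4, A5] with ω a1 a2 a3 a4 a5
  choose d hd using a1
  have hsingle : ∀ x t, (Pi.single x 1 : X → ℝ) (Y t ω) = if Y t ω = x then 1 else 0 :=
    fun x t => Pi.single_apply _ _ _
  have hfreq : ∀ x, Tendsto (fun n : ℕ => (n : ℝ)⁻¹ * ∑ t ∈ Finset.range n,
      if Y t ω = x then (1 : ℝ) else 0) atTop (𝓝 (d x)) := by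
    intro x
    obtain ⟨l, hl⟩ := a2 x
    have := tendsto_average_of_harmonic (y := fun t => Y t ω) (hg x) hl (hd x)
    simpa only [hsingle] using this
  refine ⟨d, fun x => ?_, ?_, hfreq, ?_, fun x => ?_⟩
  · exact ge_of_tendsto' (hfreq x) fun n => mul_nonneg (by positivity)
      (Finset.sum_nonneg fun t _ => by split_ifs <;> norm_num)
  · refine tendsto_nhds_unique (tendsto_finsetSum _ fun x _ => hfreq x)
      (tendsto_const_nhds.congr' ?_)
    filter_upwards [eventually_ge_atTop 1] with n hn
    have h3 : (n : ℝ) ≠ 0 := Nat.cast_ne_zero.2 (by omega)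
    rw [← Finset.mul_sum, Finset.sum_comm]
    simp [h3]
  · have hev : ∀ᶠ t in atTop, ∀ x, Y t ω = x → 0 < d x := by
      refine eventually_all.2 fun x => ?_
      by_cases hio : ∀ᶠ t in atTop, Y t ω ≠ x
      · exact hio.mono fun t ht htx => absurd htx ht
      · have hfr : ∃ᶠ t in atTop, Y t ω = x := by
          simpa [Filter.Frequently] using hio
        have hpos : 0 < h x x := by
          by_contra! hle
          exact hio (a5 x hle)
        -- Along infinitely many visits to `x` the convergent sequence `h x (Y t)` takes the value
        -- `h x x`, so this is its limit.
        have hdx : h x x = d x := by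
          by_contra hne
          obtain ⟨t, ht, ht'⟩ := (hfr.and_eventually
            ((hd x).eventually_ne (Ne.symm hne))).exists
          exact ht' (by rw [ht])
        exact Eventually.of_forall fun t _ => hdx ▸ hpos
    exact hev.mono fun t ht => ht _ rfl
  · rcases hosc with hbv | hpow
    · obtain ⟨l, hl⟩ := a3 x
      have := WindowNegligible.indicator_of_boundedVariation (y := fun t => Y t ω) hα0 hα hbv (hg x) hl (hd x)
      simpa only [hsingle] using this
    · have := WindowNegligible.indicator_of_tendsto_pow (y := fun t => Y t ω) hα0
        (tendsto_pow_mulVec_harmonic (hh x) (hg x) hpow) (a4 x) (hd x)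
      simpa only [hsingle] using this

/-! ### The contraction property of `H` -/

theorem Finset.abs_sup'_sub_sup'_le {ι : Type*} {s : Finset ι} (hs : s.Nonempty) {f g : ι → ℝ}
    {C : ℝ} (h : ∀ i ∈ s, |f i - g i| ≤ C) : |s.sup' hs f - s.sup' hs g| ≤ C := by
  rw [abs_le]
  constructor
  · rw [neg_le_sub_iff_le_add]
    refine Finset.sup'_le _ _ fun i hi => ?_
    have h1 := (abs_le.1 (h i hi)).1
    have h2 := Finset.le_sup' f hi
    linarith
  · rw [sub_le_iff_le_add]
    refine Finset.sup'_le _ _ fun i hi => ?_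
    have h1 := (abs_le.1 (h i hi)).2
    have h2 := Finset.le_sup' g hi
    linarith

section RefineOp

variable {S A : Type*} [Fintype S] [Fintype A] [Nonempty A] {h : ℕ}

theorem PMF.sum_toReal {X : Type*} [Fintype X] (p : PMF X) : ∑ x, (p x).toReal = 1 := by
  rw [← ENNReal.toReal_sum fun x _ => p.apply_ne_top x, ← tsum_fintype (L := .unconditional X),
    p.tsum_coe, ENNReal.toReal_one]

theorem refineOp_contraction (D : EpisodicMDP S A) (T : S → A → TrajRep h → TrajRep h)
    (r : S → A → ℝ) {γ : ℝ} (hγ0 : 0 ≤ γ) {K : ℕ} (hK : 1 ≤ K) {f g : S × TrajRep h → ℝ} {C : ℝ}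
    (hC : ∀ x, |f x - g x| ≤ C) (x : S × TrajRep h) :
    |refineOp D T r γ K f x - refineOp D T r γ K g x| ≤ (γ + K - 1) / (K : ℝ) * C := by
  have hK1 : (1 : ℝ) ≤ K := by exact_mod_cast hK
  have hK0 : (0 : ℝ) < K := by linarith
  set F : (S × TrajRep h → ℝ) → ℝ := fun f => Finset.univ.sup' Finset.univ_nonempty fun a =>
    ∑ s', (D.trans x.1 a s').toReal * (r x.1 a + γ * f (s', T x.1 a x.2)) with hF
  have h1 : |F f - F g| ≤ γ * C := by
    refine Finset.abs_sup'_sub_sup'_le _ fun a _ => ?_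
    rw [← Finset.sum_sub_distrib]
    calc _ ≤ ∑ s', (D.trans x.1 a s').toReal * (γ * C) := by
          refine (Finset.abs_sum_le_sum_abs _ _).trans (Finset.sum_le_sum fun s' _ => ?_)
          rw [← mul_sub, abs_mul, abs_of_nonneg ENNReal.toReal_nonneg, add_sub_add_left_eq_sub,
            ← mul_sub, abs_mul, abs_of_nonneg hγ0]
          exact mul_le_mul_of_nonneg_left (mul_le_mul_of_nonneg_left (hC _) hγ0)
            ENNReal.toReal_nonneg
      _ = γ * C := by rw [← Finset.sum_mul, PMF.sum_toReal, one_mul]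
  have e : refineOp D T r γ K f x - refineOp D T r γ K g x =
      1 / (K : ℝ) * (F f - F g) + ((K : ℝ) - 1) / K * (f x - g x) := by
    simp only [refineOp, hF]
    ring
  have h2 : 0 ≤ ((K : ℝ) - 1) / K := div_nonneg (by linarith) hK0.le
  calc _ ≤ |1 / (K : ℝ) * (F f - F g)| + |((K : ℝ) - 1) / K * (f x - g x)| := by
        rw [e]
        exact abs_add_le _ _
    _ ≤ 1 / (K : ℝ) * (γ * C) + ((K : ℝ) - 1) / K * C := by
        rw [abs_mul, abs_mul, abs_of_nonneg h2, abs_of_nonneg (by positivity : 0 ≤ 1 / (K : ℝ))]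
        exact add_le_add (mul_le_mul_of_nonneg_left h1 (by positivity))
          (mul_le_mul_of_nonneg_left (hC x) h2)
    _ = _ := by
        field_simp
        ring

end RefineOp

/-! ### Refinement of the memory: stability, mean drift and convergence -/

namespace EpisodicMemory

variable {S A : Type*} [Fintype A] [Nonempty A] {N h : ℕ} {m : EpisodicMemory N h}
  {T : S → A → TrajRep h → TrajRep h} {r : S → A → ℝ} {γ : ℝ}

theorem weight_nonneg (hm : m.IsAdmissible) (i : Fin N) (τ : TrajRep h) : 0 ≤ m.weight i τ := by
  rw [weight]
  split_ifs
  · exact div_nonneg (hm.1 i τ) (hm.2 τ).le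
  · exact le_rfl

theorem weight_of_notMem {i : Fin N} {τ : TrajRep h} (hi : i ∉ m.nbrs τ) : m.weight i τ = 0 :=
  if_neg hi

theorem sum_weight (hm : m.IsAdmissible) (τ : TrajRep h) : ∑ i ∈ m.nbrs τ, m.weight i τ = 1 := by
  rw [← div_self (hm.2 τ).ne', Finset.sum_div]
  exact Finset.sum_congr rfl fun i hi => if_pos hi

theorem weight_le_one (hm : m.IsAdmissible) (i : Fin N) (τ : TrajRep h) : m.weight i τ ≤ 1 := by
  by_cases hi : i ∈ m.nbrs τ
  · rw [← sum_weight hm τ]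
    exact Finset.single_le_sum (fun j _ => weight_nonneg hm j τ) hi
  · rw [weight_of_notMem hi]
    exact zero_le_one

/-- Reading is a convex combination, hence nonexpansive in sup norm; the factor `γ` in `target` is
then the source of contraction. -/
theorem abs_read_sub_le (hm : m.IsAdmissible) (v w : Fin N → ℝ) (τ : TrajRep h) :
    |m.read v τ - m.read w τ| ≤ ‖v - w‖ := by
  rw [read, read, ← Finset.sum_sub_distrib]
  calc _ ≤ ∑ i ∈ m.nbrs τ, m.weight i τ * ‖v - w‖ := by
        refine (Finset.abs_sum_le_sum_abs _ _).trans (Finset.sum_le_sum fun i _ => ?_)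
        rw [← mul_sub, abs_mul, abs_of_nonneg (weight_nonneg hm i τ)]
        exact mul_le_mul_of_nonneg_left (norm_le_pi_norm (v - w) i) (weight_nonneg hm i τ)
    _ = ‖v - w‖ := by rw [← Finset.sum_mul, sum_weight hm, one_mul]

theorem abs_target_sub_le (hm : m.IsAdmissible) (hγ0 : 0 ≤ γ) (z : S × TrajRep h)
    (v w : Fin N → ℝ) : |m.target T r γ z v - m.target T r γ z w| ≤ γ * ‖v - w‖ := by
  refine Finset.abs_sup'_sub_sup'_le _ fun a _ => ?_
  rw [add_sub_add_left_eq_sub, ← mul_sub, abs_mul, abs_of_nonneg hγ0]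
  exact mul_le_mul_of_nonneg_left (abs_read_sub_le hm v w _) hγ0

theorem abs_target_le (hm : m.IsAdmissible) (hγ0 : 0 ≤ γ) {R : ℝ} (hR : ∀ s a, |r s a| ≤ R)
    (z : S × TrajRep h) (v : Fin N → ℝ) : |m.target T r γ z v| ≤ R + γ * ‖v‖ := by
  have h0 : |m.target T r γ z 0| ≤ R := by
    have := Finset.abs_sup'_sub_sup'_le (Finset.univ_nonempty (α := A))
      (f := fun a => r z.1 a + γ * m.read 0 (T z.1 a z.2)) (g := fun _ => 0) (C := R)
      fun a _ => by simpa [read] using hR z.1 a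
    simpa [target] using this
  have h1 := abs_target_sub_le (T := T) (r := r) hm hγ0 z v 0
  rw [sub_zero] at h1
  have := abs_add_le (m.target T r γ z v - m.target T r γ z 0) (m.target T r γ z 0)
  rw [sub_add_cancel] at this
  linarith

/-- The refinement moves in the direction `drift`. -/
noncomputable def drift (m : EpisodicMemory N h) (T : S → A → TrajRep h → TrajRep h)
    (r : S → A → ℝ) (γ : ℝ) (z : S × TrajRep h) (v : Fin N → ℝ) : Fin N → ℝ :=
  fun i => m.weight i z.2 * (m.target T r γ z v - v i)

theorem refine_eq_add_drift (β : ℝ) (z : S × TrajRep h) (v : Fin N → ℝ) :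
    m.refine T r γ β z v = v + β • m.drift T r γ z v := by
  funext i
  simp only [refine, write, drift, Pi.add_apply, Pi.smul_apply, smul_eq_mul]
  ring

theorem norm_drift_sub_le (hm : m.IsAdmissible) (hγ0 : 0 ≤ γ) (z : S × TrajRep h)
    (v w : Fin N → ℝ) :
    ‖m.drift T r γ z v - m.drift T r γ z w‖ ≤ (γ + 1) * ‖v - w‖ := by
  refine (pi_norm_le_iff_of_nonneg (by positivity)).2 fun i => ?_
  have h1 := abs_target_sub_le (T := T) (r := r) hm hγ0 z v w
  have h2 : |v i - w i| ≤ ‖v - w‖ := norm_le_pi_norm (v - w) i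
  have e : m.drift T r γ z v i - m.drift T r γ z w i =
      m.weight i z.2 * ((m.target T r γ z v - m.target T r γ z w) - (v i - w i)) := by
    simp only [drift]
    ring
  rw [Pi.sub_apply, e, Real.norm_eq_abs, abs_mul, abs_of_nonneg (weight_nonneg hm i _)]
  calc _ ≤ 1 * |(m.target T r γ z v - m.target T r γ z w) - (v i - w i)| :=
        mul_le_mul_of_nonneg_right (weight_le_one hm i _) (abs_nonneg _)
    _ ≤ _ := by
        rw [one_mul]
        exact (abs_sub _ _).trans (by linarith)

theorem norm_drift_le (hm : m.IsAdmissible) (hγ0 : 0 ≤ γ) {R : ℝ} (hR : ∀ s a, |r s a| ≤ R)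
    (hR0 : 0 ≤ R) (z : S × TrajRep h) (v : Fin N → ℝ) :
    ‖m.drift T r γ z v‖ ≤ R + (γ + 1) * ‖v‖ := by
  refine (pi_norm_le_iff_of_nonneg (by positivity)).2 fun i => ?_
  have h1 := abs_target_le (T := T) hm hγ0 hR z v
  have h2 : |v i| ≤ ‖v‖ := norm_le_pi_norm v i
  rw [drift, Real.norm_eq_abs, abs_mul, abs_of_nonneg (weight_nonneg hm i _)]
  calc _ ≤ 1 * |m.target T r γ z v - v i| :=
        mul_le_mul_of_nonneg_right (weight_le_one hm i _) (abs_nonneg _)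
    _ ≤ _ := by
        rw [one_mul]
        exact (abs_sub _ _).trans (by linarith)

/-- A refinement with a rate in `[0, 1]` does not leave a large enough ball. -/
theorem norm_refine_le (hm : m.IsAdmissible) (hγ0 : 0 ≤ γ) {R C : ℝ} (hR : ∀ s a, |r s a| ≤ R)
    (hC : R + γ * C ≤ C) (hC0 : 0 ≤ C) {β : ℝ} (hβ0 : 0 ≤ β) (hβ1 : β ≤ 1) (z : S × TrajRep h)
    {v : Fin N → ℝ} (hv : ‖v‖ ≤ C) : ‖m.refine T r γ β z v‖ ≤ C := by
  refine (pi_norm_le_iff_of_nonneg hC0).2 fun i => ?_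
  have h1 : |m.target T r γ z v| ≤ C :=
    (abs_target_le hm hγ0 hR z v).trans
      ((add_le_add le_rfl (mul_le_mul_of_nonneg_left hv hγ0)).trans hC)
  have h2 : |v i| ≤ C := (norm_le_pi_norm v i).trans hv
  have hw0 : 0 ≤ β * m.weight i z.2 := mul_nonneg hβ0 (weight_nonneg hm i _)
  have hw1 : β * m.weight i z.2 ≤ 1 :=
    mul_le_one₀ hβ1 (weight_nonneg hm i _) (weight_le_one hm i _)
  have e : m.refine T r γ β z v i = (1 - β * m.weight i z.2) * v i +
      β * m.weight i z.2 * m.target T r γ z v := by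
    simp only [refine, write]
    ring
  rw [e, Real.norm_eq_abs]
  calc _ ≤ (1 - β * m.weight i z.2) * C + β * m.weight i z.2 * C := by
        refine (abs_add_le _ _).trans (add_le_add ?_ ?_)
        · rw [abs_mul, abs_of_nonneg (sub_nonneg.2 hw1)]
          exact mul_le_mul_of_nonneg_left h2 (sub_nonneg.2 hw1)
        · rw [abs_mul, abs_of_nonneg hw0]
          exact mul_le_mul_of_nonneg_left h1 hw0
    _ = C := by ring

theorem exists_eventually_norm_refineIter_le (hm : m.IsAdmissible) (hγ0 : 0 ≤ γ) (hγ1 : γ < 1)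
    {R : ℝ} (hR : ∀ s a, |r s a| ≤ R) {α : ℕ → ℝ} (hα0 : ∀ t, 0 ≤ α t)
    (hα : Tendsto α atTop (𝓝 0)) (z : ℕ → S × TrajRep h) (v₀ : Fin N → ℝ) :
    ∃ C, ∀ᶠ t in atTop, ‖m.refineIter T r γ α z v₀ t‖ ≤ C := by
  obtain ⟨t₀, ht₀⟩ := eventually_atTop.1 (hα.eventually (ge_mem_nhds zero_lt_one))
  -- The condition `R / (1 - γ) ≤ C` is `R + γ * C ≤ C`, so the ball is invariant once all rates are
  -- at most `1`; the other term puts the iterate at `t₀` inside.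
  set C := max ‖m.refineIter T r γ α z v₀ t₀‖ (R / (1 - γ)) with hCdef
  have hC : R + γ * C ≤ C := by
    have := le_max_right ‖m.refineIter T r γ α z v₀ t₀‖ (R / (1 - γ))
    rw [← hCdef, div_le_iff₀ (by linarith)] at this
    linarith
  have hC0 : 0 ≤ C := (norm_nonneg _).trans (le_max_left _ _)
  refine ⟨C, eventually_atTop.2 ⟨t₀, fun t ht => ?_⟩⟩
  induction t, ht using Nat.le_induction with
  | base => exact le_max_left _ _
  | succ t ht ih => exact norm_refine_le hm hγ0 hR hC hC0 (hα0 t) (ht₀ t ht) _ ih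

section Mean

variable {X : Type*} [Fintype X] (e : X → S × TrajRep h) (d : X → ℝ)

/-- Small Euler steps of the mean drift contract towards its zeros. -/
theorem norm_add_smul_mean_drift_sub_le (hm : m.IsAdmissible) (hγ0 : 0 ≤ γ) (hγ1 : γ < 1)
    (hd0 : ∀ x, 0 ≤ d x) (hd1 : ∑ x, d x = 1) {c : ℝ}
    (hc : ∀ i, ∑ x, d x * m.weight i (e x).2 ≠ 0 → c ≤ ∑ x, d x * m.weight i (e x).2)
    {v w : Fin N → ℝ} (hw : ∑ x, d x • m.drift T r γ (e x) w = 0)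
    (hvw : ∀ i, ∑ x, d x * m.weight i (e x).2 = 0 → v i = w i) {δ : ℝ} (hδ0 : 0 ≤ δ)
    (hδ1 : δ ≤ 1) (hcδ : 0 ≤ 1 - c * (1 - γ) * δ) :
    ‖v + δ • ∑ x, d x • m.drift T r γ (e x) v - w‖ ≤ (1 - c * (1 - γ) * δ) * ‖v - w‖ := by
  refine (pi_norm_le_iff_of_nonneg (mul_nonneg hcδ (norm_nonneg _))).2 fun i => ?_
  set p := ∑ x, d x * m.weight i (e x).2 with hp
  have hdw : ∀ x, 0 ≤ d x * m.weight i (e x).2 := fun x =>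
    mul_nonneg (hd0 x) (weight_nonneg hm i _)
  have hp1 : p ≤ 1 := by
    rw [hp, ← hd1]
    exact Finset.sum_le_sum fun x _ =>
      mul_le_of_le_one_right (hd0 x) (weight_le_one hm i _)
  have hp0 : 0 ≤ p := Finset.sum_nonneg fun x _ => hdw x
  set G := ∑ x, d x * m.weight i (e x).2 *
    (m.target T r γ (e x) v - m.target T r γ (e x) w) with hG
  have hGle : |G| ≤ p * (γ * ‖v - w‖) := by
    rw [hp, Finset.sum_mul]
    refine (Finset.abs_sum_le_sum_abs _ _).trans (Finset.sum_le_sum fun x _ => ?_)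
    rw [abs_mul, abs_of_nonneg (hdw x)]
    exact mul_le_mul_of_nonneg_left (abs_target_sub_le hm hγ0 _ v w) (hdw x)
  have hwi : ∑ x, d x * m.weight i (e x).2 * (m.target T r γ (e x) w - w i) = 0 := by
    have := congrFun hw i
    simpa [Finset.sum_apply, drift, mul_assoc] using this
  have hvi : (∑ x, d x • m.drift T r γ (e x) v) i = G - p * (v i - w i) := by
    rw [← sub_zero ((∑ x, d x • m.drift T r γ (e x) v) i), ← hwi, hG, hp, Finset.sum_mul,
      Finset.sum_apply, ← Finset.sum_sub_distrib, ← Finset.sum_sub_distrib]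
    refine Finset.sum_congr rfl fun x _ => ?_
    simp only [Pi.smul_apply, smul_eq_mul, drift]
    ring
  -- Since `|G| ≤ p * γ * ‖v - w‖`, coordinate `i` is bounded by `(1 - p * (1 - γ) * δ) * ‖v - w‖`;
  -- `c` bounds the nonzero masses `p` from below, and where `p = 0` the vectors agree.
  have e1 : (v + δ • ∑ x, d x • m.drift T r γ (e x) v - w) i =
      (1 - δ * p) * (v i - w i) + δ * G := by
    rw [Pi.sub_apply, Pi.add_apply, Pi.smul_apply, hvi, smul_eq_mul]
    ring
  have h2 : |v i - w i| ≤ ‖v - w‖ := norm_le_pi_norm (v - w) i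
  have hδp : δ * p ≤ 1 := mul_le_one₀ hδ1 hp0 hp1
  rw [e1, Real.norm_eq_abs]
  by_cases hpz : p = 0
  · rw [hpz, zero_mul] at hGle
    rw [hvw i hpz, abs_nonpos_iff.1 hGle]
    simpa using mul_nonneg hcδ (norm_nonneg (v - w))
  · have h3 : c * ((1 - γ) * δ) ≤ p * ((1 - γ) * δ) :=
      mul_le_mul_of_nonneg_right (hc i hpz) (mul_nonneg (by linarith) hδ0)
    calc _ ≤ (1 - δ * p) * ‖v - w‖ + δ * (p * (γ * ‖v - w‖)) := by
          refine (abs_add_le _ _).trans (add_le_add ?_ ?_)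
          · rw [abs_mul, abs_of_nonneg (sub_nonneg.2 hδp)]
            exact mul_le_mul_of_nonneg_left h2 (sub_nonneg.2 hδp)
          · rw [abs_mul, abs_of_nonneg hδ0]
            exact mul_le_mul_of_nonneg_left hGle hδ0
      _ = (1 - p * ((1 - γ) * δ)) * ‖v - w‖ := by ring
      _ ≤ _ := mul_le_mul_of_nonneg_right (by linarith) (norm_nonneg _)

/-- Gives one contraction rate for all written slots; the cap `1` keeps the Euler factor nonnegative
for steps up to `1`. -/
theorem exists_pos_le_of_ne_zero {ι : Type*} [Finite ι] {p : ι → ℝ} (hp : ∀ i, 0 ≤ p i) :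
    ∃ c, 0 < c ∧ c ≤ 1 ∧ ∀ i, p i ≠ 0 → c ≤ p i := by
  cases nonempty_fintype ι
  rcases (Finset.univ.filter fun i => p i ≠ 0).eq_empty_or_nonempty with h | h
  · refine ⟨1, one_pos, le_rfl, fun i hi => ?_⟩
    have : i ∈ Finset.univ.filter fun i => p i ≠ 0 := by simpa using hi
    rw [h] at this
    exact absurd this (Finset.notMem_empty i)
  · obtain ⟨j, hj, hmin⟩ := Finset.exists_min_image _ p h
    have hj' : p j ≠ 0 := by simpa using hj
    exact ⟨min (p j) 1, lt_min ((hp j).lt_of_ne hj'.symm) one_pos, min_le_right _ _,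
      fun i hi => (min_le_left _ _).trans (hmin i (by simpa using hi))⟩

/-- An Euler step of size `1` leaves a zero `v` in place and yet brings it strictly closer to `w`
unless they coincide. -/
theorem eq_of_mean_drift_eq_zero (hm : m.IsAdmissible) (hγ0 : 0 ≤ γ) (hγ1 : γ < 1)
    (hd0 : ∀ x, 0 ≤ d x) (hd1 : ∑ x, d x = 1) {v w : Fin N → ℝ}
    (hv : ∑ x, d x • m.drift T r γ (e x) v = 0) (hw : ∑ x, d x • m.drift T r γ (e x) w = 0)
    (hvw : ∀ i, ∑ x, d x * m.weight i (e x).2 = 0 → v i = w i) : v = w := by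
  obtain ⟨c, hc0, hc1, hc⟩ := exists_pos_le_of_ne_zero
    (p := fun i => ∑ x, d x * m.weight i (e x).2) fun i =>
      Finset.sum_nonneg fun x _ => mul_nonneg (hd0 x) (weight_nonneg hm i (e x).2)
  have hcγ : c * (1 - γ) ≤ 1 := mul_le_one₀ hc1 (by linarith) (by linarith)
  have h := norm_add_smul_mean_drift_sub_le e d hm hγ0 hγ1 hd0 hd1 hc hw hvw zero_le_one le_rfl
    (by linarith)
  rw [hv, smul_zero, add_zero, mul_one] at h
  have h1 : 0 < c * (1 - γ) := mul_pos hc0 (by linarith)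
  have h2 : ‖v - w‖ ≤ 0 := by
    by_contra! hpos
    nlinarith
  exact sub_eq_zero.1 (norm_le_zero_iff.1 h2)

/-- The mean drift has a zero with any prescribed values on the slots without weight. -/
theorem exists_mean_drift_eq_zero (hm : m.IsAdmissible) (hγ0 : 0 ≤ γ) (hγ1 : γ < 1)
    (hd0 : ∀ x, 0 ≤ d x) (v : Fin N → ℝ) :
    ∃ w : Fin N → ℝ, ∑ x, d x • m.drift T r γ (e x) w = 0 ∧
      ∀ i, ∑ x, d x * m.weight i (e x).2 = 0 → v i = w i := by
  classical
  set p : Fin N → ℝ := fun i => ∑ x, d x * m.weight i (e x).2 with hp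
  have hdw : ∀ i x, 0 ≤ d x * m.weight i (e x).2 := fun i x =>
    mul_nonneg (hd0 x) (weight_nonneg hm i _)
  have hp0 : ∀ i, 0 ≤ p i := fun i => Finset.sum_nonneg fun x _ => hdw i x
  -- Where `p i ≠ 0`, the drift vanishes exactly when `w i` is the weighted mean of the targets;
  -- elsewhere the drift is zero anyway and `w i` can be prescribed.
  let G : (Fin N → ℝ) → (Fin N → ℝ) := fun w i =>
    if p i = 0 then v i else (∑ x, d x * m.weight i (e x).2 * m.target T r γ (e x) w) / p i
  have hG : ContractingWith ⟨γ, hγ0⟩ G := by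
    refine ⟨by exact_mod_cast hγ1, LipschitzWith.of_dist_le_mul fun w w' => ?_⟩
    rw [dist_eq_norm, dist_eq_norm]
    change ‖G w - G w'‖ ≤ γ * ‖w - w'‖
    refine (pi_norm_le_iff_of_nonneg (by positivity)).2 fun i => ?_
    by_cases hpi : p i = 0
    · simp only [Pi.sub_apply, G, if_pos hpi, sub_self, norm_zero]
      positivity
    · have hpos : 0 < p i := (hp0 i).lt_of_ne (Ne.symm hpi)
      simp only [Pi.sub_apply, G, if_neg hpi]
      rw [← sub_div, ← Finset.sum_sub_distrib, Real.norm_eq_abs, abs_div, abs_of_pos hpos,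
        div_le_iff₀ hpos, mul_comm, hp, Finset.sum_mul]
      refine (Finset.abs_sum_le_sum_abs _ _).trans (Finset.sum_le_sum fun x _ => ?_)
      rw [← mul_sub, abs_mul, abs_of_nonneg (hdw i x)]
      exact mul_le_mul_of_nonneg_left (abs_target_sub_le hm hγ0 _ _ _) (hdw i x)
  have hfix := hG.fixedPoint_isFixedPt
  set w := ContractingWith.fixedPoint G hG with hw
  refine ⟨w, ?_, fun i hi => ?_⟩
  · funext i
    have hi := congrFun hfix i
    have e1 : (∑ x, d x • m.drift T r γ (e x) w) i =
        ∑ x, d x * m.weight i (e x).2 * m.target T r γ (e x) w - p i * w i := by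
      rw [Finset.sum_apply, hp, Finset.sum_mul, ← Finset.sum_sub_distrib]
      refine Finset.sum_congr rfl fun x _ => ?_
      simp only [Pi.smul_apply, smul_eq_mul, drift]
      ring
    rw [e1, Pi.zero_apply]
    by_cases hpi : p i = 0
    · have hz := fun x => (Finset.sum_eq_zero_iff_of_nonneg fun x _ => hdw i x).1 hpi x
        (Finset.mem_univ x)
      simp [hz, hpi]
    · simp only [G, if_neg hpi] at hi
      rw [div_eq_iff hpi] at hi
      rw [hi]
      ring
  · have hi' := congrFun hfix i
    simp only [G] at hi'
    rw [if_pos hi] at hi'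
    exact hi'

/-- Repeated refinement converges along a path that averages out to `d`. -/
theorem exists_tendsto_refineIter [DecidableEq X] (hm : m.IsAdmissible) (hγ0 : 0 ≤ γ)
    (hγ1 : γ < 1) {R : ℝ} (hR : ∀ s a, |r s a| ≤ R) (hR0 : 0 ≤ R)
    {α : ℕ → ℝ} (hα0 : ∀ t, 0 ≤ α t) (hα1 : ¬ Summable α) (hα : Tendsto α atTop (𝓝 0))
    (hd0 : ∀ x, 0 ≤ d x) (hd1 : ∑ x, d x = 1) (z : ℕ → X) (hz : ∀ᶠ t in atTop, 0 < d (z t))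
    (hd : ∀ x, WindowNegligible α fun s => (if z s = x then 1 else 0) - d x)
    (v₀ : Fin N → ℝ) :
    ∃ w : Fin N → ℝ, ∑ x, d x • m.drift T r γ (e x) w = 0 ∧
      Tendsto (fun t => m.refineIter T r γ α (fun k => e (z k)) v₀ t) atTop (𝓝 w) := by
  set v := m.refineIter T r γ α (fun k => e (z k)) v₀ with hv
  have hrec : ∀ t, v (t + 1) = v t + α t • m.drift T r γ (e (z t)) (v t) := fun t =>
    refine_eq_add_drift _ _ _
  obtain ⟨C, hC⟩ := exists_eventually_norm_refineIter_le (T := T) hm hγ0 hγ1 hR hα0 hα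
    (fun k => e (z k)) v₀
  obtain ⟨c, hc0, hc1, hc⟩ := exists_pos_le_of_ne_zero
    (p := fun i => ∑ x, d x * m.weight i (e x).2) fun i =>
      Finset.sum_nonneg fun x _ => mul_nonneg (hd0 x) (weight_nonneg hm i (e x).2)
  obtain ⟨t₀, ht₀⟩ := eventually_atTop.1 hz
  -- From `t₀` on only states of positive frequency are visited, so slots of mean weight zero keep
  -- their value at `t₀`; the limit inherits it.
  obtain ⟨w, hw, hwv⟩ := exists_mean_drift_eq_zero (T := T) (r := r) e d hm hγ0 hγ1 hd0 (v t₀)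
  have hfrozen : ∀ t ≥ t₀, ∀ i, ∑ x, d x * m.weight i (e x).2 = 0 → v t i = w i := by
    intro t ht i hi
    induction t, ht using Nat.le_induction with
    | base => exact hwv i hi
    | succ t ht ih =>
      have h1 := (Finset.sum_eq_zero_iff_of_nonneg fun x _ =>
        mul_nonneg (hd0 x) (weight_nonneg hm i (e x).2)).1 hi (z t) (Finset.mem_univ _)
      have h2 := (mul_eq_zero.1 h1).resolve_left (ht₀ t ht).ne'
      rw [hrec, Pi.add_apply, ih, Pi.smul_apply, drift, h2, zero_mul, smul_zero, add_zero]
  refine ⟨w, hw, ?_⟩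
  have hcγ : c * (1 - γ) ≤ 1 := mul_le_one₀ hc1 (by linarith) (by linarith)
  have hcγ0 : 0 < c * (1 - γ) := mul_pos hc0 (by linarith)
  refine tendsto_of_windowNegligible hα0 hα1 hα z d hd (fun x => m.drift T r γ (e x))
    (L := γ + 1) (B := max C (R + (γ + 1) * C)) (c := c * (1 - γ)) (by linarith)
    (fun x => norm_drift_sub_le hm hγ0 (e x)) v hrec ?_
    (hC.mono fun t ht => ht.trans (le_max_left _ _)) hcγ0 w ?_
  · filter_upwards [hC] with t ht x
    refine (norm_drift_le hm hγ0 hR hR0 _ _).trans (le_trans ?_ (le_max_right _ _))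
    exact add_le_add le_rfl (mul_le_mul_of_nonneg_left ht (by linarith))
  · filter_upwards [eventually_ge_atTop t₀] with t ht δ hδ0 hδ1
    have hle : c * (1 - γ) * δ ≤ 1 := mul_le_one₀ hcγ hδ0 hδ1
    exact norm_add_smul_mean_drift_sub_le e d hm hγ0 hγ1 hd0 hd1 hc hw (hfrozen t ht) hδ0 hδ1
      (by linarith)

end Mean

/-- The read-out after an action does not depend on the next state, so the expectation in `H`
collapses to `target`. -/
theorem refineOp_read_eq [Fintype S] (D : EpisodicMDP S A) {K : ℕ} (v : Fin N → ℝ)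
    (z : S × TrajRep h) :
    refineOp D T r γ K (fun x => m.read v x.2) z =
      1 / (K : ℝ) * m.target T r γ z v + ((K : ℝ) - 1) / K * m.read v z.2 := by
  simp only [refineOp, target, ← Finset.sum_mul, PMF.sum_toReal, one_mul]

/-- The read-out changes by `β * ∑ B_i ^ 2 * (V - v_i)`; with `B_i = 1 / K` this is `β / K` times
target minus read-out, that is, `β` times `H` minus identity. -/
theorem read_refine_of_weight_eq [Fintype S] (hm : m.IsAdmissible) (D : EpisodicMDP S A) {K : ℕ}
    (hK : 1 ≤ K) {z : S × TrajRep h}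
    (hw : ∀ i ∈ m.nbrs z.2, m.weight i z.2 = 1 / (K : ℝ)) (β : ℝ) (v : Fin N → ℝ) :
    m.read (m.refine T r γ β z v) z.2 =
      (1 - β) * m.read v z.2 + β * refineOp D T r γ K (fun x => m.read v x.2) z := by
  have hK0 : (K : ℝ) ≠ 0 := by
    have : 0 < K := hK
    positivity
  have e : m.read (m.refine T r γ β z v) z.2 = m.read v z.2 +
      β * (1 / (K : ℝ)) * (m.target T r γ z v * ∑ i ∈ m.nbrs z.2, m.weight i z.2 -
        m.read v z.2) := by
    rw [mul_sub, Finset.mul_sum, Finset.mul_sum, read, read, Finset.mul_sum,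
      ← Finset.sum_sub_distrib, ← Finset.sum_add_distrib]
    refine Finset.sum_congr rfl fun i hi => ?_
    simp only [refine, write]
    rw [hw i hi]
    ring
  rw [e, sum_weight hm, refineOp_read_eq]
  field_simp
  ring

end EpisodicMemory

/-! ### Reduction of the interaction to a chain on the reachable pairs -/

/-- Extending a probability vector on a set by zero. -/
theorem exists_pmf_extend {E : Type*} {R : Set E} [Fintype R] {d : R → ℝ} (hd0 : ∀ x, 0 ≤ d x)
    (hd1 : ∑ x, d x = 1) :
    ∃ p : PMF E, (∀ x : R, (p x).toReal = d x) ∧ ∀ z ∉ R, p z = 0 := by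
  let q : PMF R := PMF.ofFintype (fun x => ENNReal.ofReal (d x)) (by
    rw [← ENNReal.ofReal_sum_of_nonneg fun x _ => hd0 x, hd1, ENNReal.ofReal_one])
  refine ⟨q.map Subtype.val, fun x => ?_, fun z hz => ?_⟩
  · rw [PMF.map_apply, tsum_eq_single x fun y hy => if_neg fun h => hy (Subtype.ext h.symm),
      if_pos rfl, PMF.ofFintype_apply, ENNReal.toReal_ofReal (hd0 x)]
  · rw [PMF.map_apply, ENNReal.tsum_eq_zero]
    intro y
    rw [if_neg]
    rintro rfl
    exact hz y.2

theorem tsum_eq_sum_subtype {E : Type*} {R : Set E} [Fintype R] {f : E → ℝ}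
    (hf : ∀ z ∉ R, f z = 0) : ∑' z, f z = ∑ x : R, f x := by
  rw [← tsum_subtype_eq_of_support_subset (s := R) fun z hz => by
    by_contra h
    exact hz (hf z h), tsum_fintype]

theorem PMF.sum_subtype_toReal {E : Type*} {R : Set E} [Fintype R] (p : PMF E)
    (hp : ∀ z ∉ R, p z = 0) : ∑ x : R, (p x).toReal = 1 := by
  rw [← ENNReal.toReal_sum (f := fun x : R => p x) fun x _ => p.apply_ne_top x,
    ← tsum_fintype (L := .unconditional R) (fun x : R => p x),
    tsum_subtype_eq_of_support_subset (s := R) fun z hz => by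
      by_contra h
      exact hz (hp z h), p.tsum_coe, ENNReal.toReal_one]

theorem PMF.bind_toReal_eq_sum_subtype {E F : Type*} {R : Set E} [Fintype R] (p : PMF E)
    (hp : ∀ z ∉ R, p z = 0) (f : E → PMF F) (y : F) :
    (p.bind f y).toReal = ∑ x : R, (p x).toReal * (f x y).toReal := by
  rw [PMF.bind_apply, ← tsum_subtype_eq_of_support_subset (s := R) fun z hz => by
      by_contra h
      exact hz (by simp [hp z h]), tsum_fintype,
    ENNReal.toReal_sum fun x _ => ENNReal.mul_ne_top (p.apply_ne_top _) ((f _).apply_ne_top _)]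
  simp only [ENNReal.toReal_mul]

namespace EpisodicMDP

variable {S A : Type*} {h : ℕ} {D : EpisodicMDP S A} {T : S → A → TrajRep h → TrajRep h}
  {π : S × TrajRep h → PMF A}

theorem startLaw_eq_zero {z : S × TrajRep h} (hz : z ∉ D.reachable T π) :
    (D.startLaw z : ENNReal) = 0 := by
  by_contra hne
  exact hz ⟨0, hne⟩

theorem step_eq_zero {z z' : S × TrajRep h} (hz : z ∈ D.reachable T π)
    (hz' : z' ∉ D.reachable T π) : D.step T π z z' = 0 := by
  by_contra hne
  obtain ⟨n, hn⟩ := hz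
  refine hz' ⟨n + 1, ?_⟩
  rw [← PMF.mem_support_iff]
  exact (PMF.mem_support_bind_iff _ _ _).2 ⟨z, hn, hne⟩

theorem reachable_nonempty : (D.reachable T π).Nonempty := by
  obtain ⟨z, hz⟩ := (D.startLaw (h := h)).support_nonempty
  exact ⟨z, 0, hz⟩

theorem lawFrom_pure_eq_zero {z : S × TrajRep h} (hz : z ∈ D.reachable T π) (n : ℕ) :
    ∀ z' ∉ D.reachable T π, D.lawFrom T π (PMF.pure z) n z' = 0 := by
  induction n with
  | zero =>
    intro z' hz'
    exact PMF.pure_apply_of_ne _ _ fun h => hz' (h ▸ hz)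
  | succ n ih =>
    intro z' hz'
    change (D.lawFrom T π (PMF.pure z) n).bind (D.step T π) z' = 0
    rw [PMF.bind_apply, ENNReal.tsum_eq_zero]
    intro y
    by_cases hy : y ∈ D.reachable T π
    · rw [step_eq_zero hy hz', mul_zero]
    · rw [ih y hy, zero_mul]

/-- The transition matrix of the interaction on the reachable pairs. -/
noncomputable def transMatrix (D : EpisodicMDP S A) (T : S → A → TrajRep h → TrajRep h)
    (π : S × TrajRep h → PMF A) : Matrix (D.reachable T π) (D.reachable T π) ℝ :=
  fun x y => (D.step T π x y).toReal

variable [Fintype (D.reachable T π)]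

theorem transMatrix_mem_rowStochastic [DecidableEq (D.reachable T π)] :
    D.transMatrix T π ∈ Matrix.rowStochastic ℝ (D.reachable T π) :=
  Matrix.mem_rowStochastic_iff_sum.2 ⟨fun _ _ => ENNReal.toReal_nonneg, fun x =>
    (D.step T π x).sum_subtype_toReal fun _ hz => step_eq_zero x.2 hz⟩

/-- Carries the aperiodicity assumption over to matrix powers. -/
theorem transMatrix_pow_apply [DecidableEq (D.reachable T π)] (x y : D.reachable T π) (n : ℕ) :
    (D.transMatrix T π ^ n) x y = (D.lawFrom T π (PMF.pure x.1) n y).toReal := by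
  induction n generalizing y with
  | zero =>
    rw [pow_zero, Matrix.one_apply]
    change _ = (PMF.pure x.1 y.1).toReal
    by_cases hxy : x = y
    · simp [hxy]
    · rw [if_neg hxy, PMF.pure_apply_of_ne _ _ fun h => hxy (Subtype.ext h.symm),
        ENNReal.toReal_zero]
  | succ n ih =>
    change _ = ((D.lawFrom T π (PMF.pure x.1) n).bind (D.step T π) y).toReal
    rw [PMF.bind_toReal_eq_sum_subtype _ (lawFrom_pure_eq_zero x.2 n), pow_succ, Matrix.mul_apply]
    exact Finset.sum_congr rfl fun w _ => by rw [ih]; rfl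

namespace IsInteraction

set_option linter.unusedSectionVars false

variable {Ω : Type*} [MeasurableSpace Ω] {μ : Measure Ω} [IsProbabilityMeasure μ]
  {Z : ℕ → Ω → S × TrajRep h}

theorem measurableSet_cylinder (hZ : D.IsInteraction T π μ Z) (n : ℕ) (z : ℕ → S × TrajRep h) :
    MeasurableSet {ω | ∀ j ≤ n, Z j ω = z j} := by
  have e : {ω | ∀ j ≤ n, Z j ω = z j} = ⋂ j ∈ Set.Iic n, {ω | Z j ω = z j} := by
    ext ω
    simp
  rw [e]
  exact MeasurableSet.biInter (Set.to_countable _) fun j _ => hZ.1 j _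

theorem measure_cylinder_succ (hZ : D.IsInteraction T π μ Z) (n : ℕ) (z : ℕ → S × TrajRep h) :
    μ {ω | ∀ j ≤ n + 1, Z j ω = z j} =
      μ {ω | ∀ j ≤ n, Z j ω = z j} * D.step T π (z n) (z (n + 1)) := by
  rw [hZ.2, hZ.2, Finset.prod_range_succ, mul_assoc]

theorem ae_mem_reachable_zero (hZ : D.IsInteraction T π μ Z) :
    ∀ᵐ ω ∂μ, Z 0 ω ∈ D.reachable T π := by
  have hU : {ω | Z 0 ω ∈ D.reachable T π} = ⋃ x : D.reachable T π, {ω | Z 0 ω = x} := by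
    ext ω
    simp
  have hm : MeasurableSet {ω | Z 0 ω ∈ D.reachable T π} := by
    rw [hU]
    exact MeasurableSet.iUnion fun x => hZ.1 0 x
  rw [Filter.Eventually, mem_ae_iff_prob_eq_one hm, hU,
    measure_iUnion (f := fun x : D.reachable T π => {ω | Z 0 ω = x.1})
    (fun x y hxy => Set.disjoint_left.2 fun ω hx hy => hxy (Subtype.ext (hx.symm.trans hy)))
    fun x => hZ.1 0 x, ← (D.startLaw (h := h)).tsum_coe,
    ← tsum_subtype_eq_of_support_subset (s := D.reachable T π) fun z hz => by
      by_contra h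
      exact hz (startLaw_eq_zero h)]
  refine tsum_congr fun x => ?_
  have := hZ.2 0 fun _ => x.1
  simpa using this

/-- For a fixed reachable past, the cylinders continuing it to a reachable pair carry its full mass,
since `step` gives no mass to other pairs. There are finitely many such pasts. -/
theorem ae_mem_reachable_succ (hZ : D.IsInteraction T π μ Z) (n : ℕ) :
    ∀ᵐ ω ∂μ, (∀ j ≤ n, Z j ω ∈ D.reachable T π) → Z (n + 1) ω ∈ D.reachable T π := by
  have key : ∀ p : Fin (n + 1) → D.reachable T π,
      ∀ᵐ ω ∂μ, (∀ j : Fin (n + 1), Z j ω = p j) → Z (n + 1) ω ∈ D.reachable T π := by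
    intro p
    -- The clamp only makes `y` total; indices beyond `n` are overwritten or irrelevant.
    let y : ℕ → S × TrajRep h := fun j => p ⟨min j n, by omega⟩
    have hy : ∀ j : Fin (n + 1), y j = p j := fun j => by
      simp only [y, min_eq_left (Nat.le_of_lt_succ j.2)]
    set C := {ω | ∀ j ≤ n, Z j ω = y j} with hC
    let B : D.reachable T π → Set Ω := fun x => {ω | ∀ j ≤ n + 1,
      Z j ω = Function.update y (n + 1) x.1 j}
    have hupd : ∀ (x : D.reachable T π) j, j ≤ n → Function.update y (n + 1) x.1 j = y j :=
      fun x j hj => Function.update_of_ne (by omega) _ _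
    have hB : ∀ x, B x = {ω | ω ∈ C ∧ Z (n + 1) ω = x} := by
      intro x
      ext ω
      constructor
      · intro hω
        refine ⟨fun j hj => (hω j (by omega)).trans (hupd x j hj), ?_⟩
        exact (hω (n + 1) le_rfl).trans (Function.update_self _ _ _)
      · rintro ⟨h1, h2⟩ j hj
        rcases Nat.le_succ_iff.1 hj with hj | rfl
        · exact (h1 j hj).trans (hupd x j hj).symm
        · exact h2.trans (Function.update_self (n + 1) x.1 y).symm
    have hBm : ∀ x, MeasurableSet (B x) := fun x => measurableSet_cylinder hZ _ _
    have hBμ : ∀ x, μ (B x) = μ C * D.step T π (y n) x := by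
      intro x
      have := measure_cylinder_succ hZ n (Function.update y (n + 1) x.1)
      rw [Function.update_self, hupd x n le_rfl] at this
      refine this.trans ?_
      congr 2
      ext ω
      exact forall₂_congr fun j hj => by rw [hupd x j hj]
    have hyn : y n ∈ D.reachable T π := (p _).2
    have hdisj : Pairwise (Function.onFun Disjoint B) := fun x x' hxx =>
      Set.disjoint_left.2 fun ω h1 h2 => by
        rw [hB] at h1 h2
        exact hxx (Subtype.ext (h1.2.symm.trans h2.2))
    have hU : μ (⋃ x, B x) = μ C := by
      rw [measure_iUnion hdisj hBm, tsum_congr hBμ, ENNReal.tsum_mul_left,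
        tsum_subtype_eq_of_support_subset (s := D.reachable T π) fun z hz => by
          by_contra h
          exact hz (step_eq_zero hyn h), PMF.tsum_coe, mul_one]
    have hsub : (⋃ x, B x) ⊆ C := Set.iUnion_subset fun x ω hω => by
      rw [hB] at hω
      exact hω.1
    have hzero : μ (C \ ⋃ x, B x) = 0 := by
      rw [measure_sdiff hsub (MeasurableSet.iUnion hBm).nullMeasurableSet (measure_ne_top _ _), hU,
        tsub_self]
    filter_upwards [measure_eq_zero_iff_ae_notMem.1 hzero] with ω hω hp
    by_contra hnot
    refine hω ⟨fun j hj => ?_, fun hmem => ?_⟩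
    · rw [hp ⟨j, Nat.lt_succ_of_le hj⟩, ← hy]
    · obtain ⟨x, hx⟩ := Set.mem_iUnion.1 hmem
      rw [hB] at hx
      exact hnot (hx.2 ▸ x.2)
  filter_upwards [ae_all_iff.2 key] with ω hω hall
  exact hω (fun j => ⟨Z j ω, hall j (Nat.le_of_lt_succ j.2)⟩) fun j => rfl

theorem ae_mem_reachable (hZ : D.IsInteraction T π μ Z) :
    ∀ᵐ ω ∂μ, ∀ t, Z t ω ∈ D.reachable T π := by
  filter_upwards [ae_mem_reachable_zero hZ, ae_all_iff.2 (ae_mem_reachable_succ hZ)] with ω h0 h1 t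
  induction t using Nat.strong_induction_on with
  | _ t ih =>
    rcases t with _ | t
    · exact h0
    · exact h1 t fun j hj => ih j (Nat.lt_succ_of_le hj)

/-- The interaction, up to a null set, is a Markov chain on the finite set of reachable pairs. -/
theorem exists_isMarkovChain (hZ : D.IsInteraction T π μ Z)
    [DecidableEq (D.reachable T π)] [MeasurableSpace (D.reachable T π)]
    [MeasurableSingletonClass (D.reachable T π)] :
    ∃ Y : ℕ → Ω → D.reachable T π, IsMarkovChain μ (D.transMatrix T π) Y ∧
      ∀ᵐ ω ∂μ, ∀ t, (Y t ω).1 = Z t ω := by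
  classical
  obtain ⟨z₀, hz₀⟩ := reachable_nonempty (D := D) (T := T) (π := π)
  -- The default `z₀` is taken only on a null set.
  let Y : ℕ → Ω → D.reachable T π := fun t ω =>
    if hω : Z t ω ∈ D.reachable T π then ⟨Z t ω, hω⟩ else ⟨z₀, hz₀⟩
  have hYZ : ∀ t ω, Z t ω ∈ D.reachable T π → (Y t ω).1 = Z t ω := by
    intro t ω hω
    simp only [Y, dif_pos hω]
  have hae : ∀ᵐ ω ∂μ, ∀ t, (Y t ω).1 = Z t ω := by
    filter_upwards [ae_mem_reachable hZ] with ω hω t using hYZ t ω (hω t)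
  refine ⟨Y, ⟨fun t => ?_, fun n y => ?_⟩, hae⟩
  · refine measurable_to_countable' fun x => ?_
    have hU : MeasurableSet {ω | Z t ω ∈ D.reachable T π} := by
      have e : {ω | Z t ω ∈ D.reachable T π} = ⋃ x : D.reachable T π, {ω | Z t ω = x} := by
        ext ω
        simp
      rw [e]
      exact MeasurableSet.iUnion fun x => hZ.1 t x
    have e : Y t ⁻¹' {x} = {ω | Z t ω = x} ∪
        ({ω | Z t ω ∈ D.reachable T π}ᶜ ∩ {_ω | (⟨z₀, hz₀⟩ : D.reachable T π) = x}) := by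
      ext ω
      by_cases hω : Z t ω ∈ D.reachable T π
      · simp [Y, hω, Subtype.ext_iff]
      · have hne : Z t ω ≠ x := fun hx => hω (hx ▸ x.2)
        simp [Y, hω, hne]
    rw [e]
    exact (hZ.1 t x).union (hU.compl.inter (MeasurableSet.const _))
  · have hcyl : ∀ n, μ {ω | ∀ j ≤ n, Y j ω = y j} = μ {ω | ∀ j ≤ n, Z j ω = (y j).1} := by
      intro n
      refine measure_congr ?_
      filter_upwards [hae] with ω hω
      refine propext (forall₂_congr fun j _ => ?_)
      rw [← hω j, Subtype.ext_iff]
    rw [Measure.real, Measure.real, hcyl, hcyl, measure_cylinder_succ hZ n fun j => (y j).1,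
      ENNReal.toReal_mul]
    rfl

end IsInteraction

end EpisodicMDP

/-! ### Fixed points of the expected update and the main theorem -/

theorem natCard_visits_eq_sum {E : Type*} [DecidableEq E] (y : ℕ → E) (x : E) (n : ℕ) :
    (Nat.card {t : ℕ // t < n ∧ y t = x} : ℝ) =
      ∑ t ∈ Finset.range n, if y t = x then (1 : ℝ) else 0 := by
  rw [Finset.sum_boole, Nat.subtype_card ((Finset.range n).filter fun t => y t = x)]
  intro t
  simp

namespace EpisodicMemory

variable {S A : Type*} [Fintype A] [Nonempty A] {N h : ℕ} {m : EpisodicMemory N h}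
  {T : S → A → TrajRep h → TrajRep h} {r : S → A → ℝ} {γ : ℝ}
  {R : Set (S × TrajRep h)} [Fintype R]

/-- Hence a zero of the mean drift is fixed at every rate, and a fixed point at rate `1` is such a
zero. -/
theorem meanRefine_eq_add {p : PMF (S × TrajRep h)} (hp : ∀ z ∉ R, p z = 0) (β : ℝ)
    (v : Fin N → ℝ) :
    m.meanRefine T r γ β p v = v + β • ∑ x : R, (p x).toReal • m.drift T r γ x v := by
  funext i
  rw [meanRefine, tsum_eq_sum_subtype (R := R) fun z hz => by simp [hp z hz]]
  simp only [refine_eq_add_drift, Pi.add_apply, Pi.smul_apply, smul_eq_mul, Finset.sum_apply,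
    mul_add, Finset.sum_add_distrib]
  rw [← Finset.sum_mul, p.sum_subtype_toReal hp, one_mul, Finset.mul_sum]
  congr 1
  exact Finset.sum_congr rfl fun x _ => by ring

/-- A zero of the mean drift solves the fixed point equation of `H` wherever the neighbours are not
shared. -/
theorem refineOp_read_eq_of_disjoint [Fintype S] (hm : m.IsAdmissible) (D : EpisodicMDP S A)
    {K : ℕ} (hK : 1 ≤ K) {p : PMF (S × TrajRep h)} (hp : ∀ z ∉ R, p z = 0) {v : Fin N → ℝ}
    (hv : ∑ x : R, (p x).toReal • m.drift T r γ x v = 0) {z : S × TrajRep h} (hz : p z ≠ 0)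
    (hdisj : ∀ z', p z' ≠ 0 → z' ≠ z → Disjoint (m.nbrs z.2) (m.nbrs z'.2)) :
    refineOp D T r γ K (fun x => m.read v x.2) z = m.read v z.2 := by
  have hzR : z ∈ R := by
    by_contra h
    exact hz (hp z h)
  -- Only `z` contributes to the mean drift of its own slots. The weight stays as a factor because a
  -- neighbour may have weight zero.
  have hslot : ∀ i ∈ m.nbrs z.2, m.weight i z.2 * v i = m.weight i z.2 * m.target T r γ z v := by
    intro i hi
    have h1 := congrFun hv i
    rw [Finset.sum_apply, Finset.sum_eq_single (⟨z, hzR⟩ : R) ?_ (by simp)] at h1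
    · have h2 := (mul_eq_zero.1 h1).resolve_left
        (ENNReal.toReal_ne_zero.2 ⟨hz, p.apply_ne_top z⟩)
      rw [drift] at h2
      linarith
    · intro x _ hx
      by_cases hpx : p x = 0
      · simp [hpx]
      · have hi' := Finset.disjoint_left.1
          (hdisj x hpx fun h => hx (Subtype.ext h)) hi
        simp [drift, weight_of_notMem hi']
  have hread : m.read v z.2 = m.target T r γ z v := by
    rw [read, Finset.sum_congr rfl hslot, ← Finset.sum_mul, sum_weight hm, one_mul]
  have hK0 : (K : ℝ) ≠ 0 := by
    have : 0 < K := hK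
    positivity
  rw [refineOp_read_eq, hread]
  field_simp
  ring

end EpisodicMemory

theorem mainTheorem1
    {S A : Type*} [Fintype S] [Fintype A] [Nonempty A] {N h : ℕ}
    (D : EpisodicMDP S A)
    (T : S → A → TrajRep h → TrajRep h)
    (π : S × TrajRep h → PMF A)
    (hfin : (D.reachable T π).Finite)
    (r : S → A → ℝ) (γ : ℝ) (hγ0 : 0 ≤ γ) (hγ1 : γ < 1)
    (m : EpisodicMemory N h) (K : ℕ) (hK : 1 ≤ K)
    (hnbrs : m.IsKNearest K) (hker : m.IsAdmissible)
    (α : ℕ → ℝ) (hα0 : ∀ t, 0 ≤ α t) (hα1 : ¬ Summable α)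
    (hα2 : Summable fun t => α t ^ 2)
    (hosc : (Summable fun t => |α (t + 1) - α t|) ∨
      ∀ z ∈ D.reachable T π, ∀ z', ∃ p : ℝ,
        Tendsto (fun n => (D.lawFrom T π (PMF.pure z) n z').toReal) atTop (𝓝 p))
    {Ω : Type*} [MeasurableSpace Ω] (μ : Measure Ω) [IsProbabilityMeasure μ]
    (Z : ℕ → Ω → S × TrajRep h) (hZ : D.IsInteraction T π μ Z)
    (v₀ : Fin N → ℝ) :
    -- almost sure convergence of the memory to a fixed point
    (∀ᵐ ω ∂μ, ∃ (d : PMF (S × TrajRep h)) (v : Fin N → ℝ),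
      -- `d` is the long-run distribution of the refined pairs
      (∀ z, Tendsto
        (fun n : ℕ => (Nat.card {t : ℕ // t < n ∧ Z t ω = z} : ℝ) / n)
        atTop (𝓝 (d z).toReal)) ∧
      -- `v` is a fixed point of the expected `refine` update, whatever its rate
      (∀ β : ℝ, m.meanRefine T r γ β d v = v) ∧
      -- and it is the only one with its values on the slots that are not written any more
      (∀ v' : Fin N → ℝ, m.meanRefine T r γ 1 d v' = v' →
        (∀ i, (∀ z, d z ≠ 0 → m.weight i z.2 = 0) → v' i = v i) → v' = v) ∧
      -- the stored values, and so the read-outs, converge to those of `v`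
      Tendsto (fun t => m.refineIter T r γ α (fun k => Z k ω) v₀ t) atTop (𝓝 v) ∧
      (∀ τ, Tendsto (fun t => m.read (m.refineIter T r γ α (fun k => Z k ω) v₀ t) τ)
        atTop (𝓝 (m.read v τ))) ∧
      -- the limit solves `H f = f` wherever the neighbours are not shared
      (∀ z, d z ≠ 0 → (∀ z', d z' ≠ 0 → z' ≠ z → Disjoint (m.nbrs z.2) (m.nbrs z'.2)) →
        refineOp D T r γ K (fun x => m.read v x.2) z = m.read v z.2)) ∧
    -- if all neighbour weights are `1 / K`, then `refine` moves the read-out towards `H`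
    (∀ (z : S × TrajRep h) (β : ℝ) (v : Fin N → ℝ),
      (∀ i ∈ m.nbrs z.2, m.weight i z.2 = 1 / (K : ℝ)) →
      m.read (m.refine T r γ β z v) z.2 =
        (1 - β) * m.read v z.2 + β * refineOp D T r γ K (fun x => m.read v x.2) z) ∧
    -- `H` is a sup-norm contraction with modulus `(γ + K - 1) / K < 1`
    (γ + K - 1) / (K : ℝ) < 1 ∧
    (∀ (f g : S × TrajRep h → ℝ) (C : ℝ), (∀ x, |f x - g x| ≤ C) →
      ∀ x, |refineOp D T r γ K f x - refineOp D T r γ K g x| ≤ (γ + K - 1) / (K : ℝ) * C) := by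
  classical
  refine ⟨?_, fun z β v hw => EpisodicMemory.read_refine_of_weight_eq hker D hK hw β v, ?_,
    fun f g C hC x => refineOp_contraction D T r hγ0 hK hC x⟩
  swap
  · have hK0 : (0 : ℝ) < K := by exact_mod_cast hK
    rw [div_lt_one hK0]
    linarith
  let : Fintype (D.reachable T π) := hfin.fintype
  let : MeasurableSpace (D.reachable T π) := ⊤
  have : MeasurableSingletonClass (D.reachable T π) := ⟨fun _ => trivial⟩
  obtain ⟨Y, hY, hYZ⟩ := hZ.exists_isMarkovChain
  -- Square summability gives `α t ^ 2 → 0`, and the square root recovers `α t ≥ 0`.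
  have hα : Tendsto α atTop (𝓝 0) := by
    have h1 := hα2.tendsto_atTop_zero.sqrt
    rw [Real.sqrt_zero] at h1
    exact h1.congr fun t => Real.sqrt_sq (hα0 t)
  have hosc' : (Summable fun t => |α (t + 1) - α t|) ∨ ∀ x y, ∃ p,
      Tendsto (fun n => (D.transMatrix T π ^ n) x y) atTop (𝓝 p) := by
    refine hosc.imp_right fun hap x y => ?_
    obtain ⟨p, hp⟩ := hap x.1 x.2 y
    exact ⟨p, hp.congr fun n => (EpisodicMDP.transMatrix_pow_apply x y n).symm⟩
  have hR : ∃ R : ℝ, 0 ≤ R ∧ ∀ s a, |r s a| ≤ R :=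
    ⟨‖r‖, norm_nonneg r, fun s a => (norm_le_pi_norm (r s) a).trans (norm_le_pi_norm r s)⟩
  obtain ⟨R, hR0, hR⟩ := hR
  filter_upwards [hYZ, hY.ae_exists_occupation EpisodicMDP.transMatrix_mem_rowStochastic hα0 hα2
    hα hosc'] with ω hω ⟨d, hd0, hd1, hfreq, hsupp, hneg⟩
  obtain ⟨p, hpd, hp⟩ := exists_pmf_extend hd0 hd1
  obtain ⟨v, hv, hlim⟩ := EpisodicMemory.exists_tendsto_refineIter (m := m) (T := T) (r := r)
    Subtype.val d hker hγ0 hγ1 hR hR0 hα0 hα1 hα hd0 hd1 (fun t => Y t ω) hsupp hneg v₀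
  have hpath : (fun k => Z k ω) = fun k => (Y k ω).1 := funext fun k => (hω k).symm
  have hv' : ∑ x : D.reachable T π, (p x).toReal • m.drift T r γ x v = 0 := by
    simpa only [hpd] using hv
  rw [hpath]
  refine ⟨p, v, fun z => ?_, fun β => ?_, fun w hw hwv => ?_, hlim, fun τ => ?_,
    fun z hz hdisj => EpisodicMemory.refineOp_read_eq_of_disjoint hker D hK hp hv' hz hdisj⟩
  · simp only [← hω]
    by_cases hz : z ∈ D.reachable T π
    · have e : ∀ t, (Y t ω).1 = z ↔ Y t ω = ⟨z, hz⟩ := fun t =>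
        ⟨fun h => Subtype.ext h, fun h => congrArg Subtype.val h⟩
      simp only [e, natCard_visits_eq_sum (fun t => Y t ω)]
      rw [hpd ⟨z, hz⟩]
      exact (hfreq ⟨z, hz⟩).congr fun n => (div_eq_inv_mul _ _).symm
    · have e : ∀ t, (Y t ω).1 = z ↔ False := fun t =>
        ⟨fun h => hz (h ▸ (Y t ω).2), False.elim⟩
      simp [e, hp z hz]
  · rw [EpisodicMemory.meanRefine_eq_add hp, hv', smul_zero, add_zero]
  · rw [EpisodicMemory.meanRefine_eq_add hp, one_smul, add_eq_left] at hw
    simp only [hpd] at hw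
    refine EpisodicMemory.eq_of_mean_drift_eq_zero Subtype.val d hker hγ0 hγ1 hd0 hd1 hw hv
      fun i hi => hwv i fun z hz => ?_
    have hzR : z ∈ D.reachable T π := by
      by_contra h
      exact hz (hp z h)
    have h1 := (Finset.sum_eq_zero_iff_of_nonneg fun x _ => mul_nonneg (hd0 x)
      (EpisodicMemory.weight_nonneg hker i x.1.2)).1 hi ⟨z, hzR⟩ (Finset.mem_univ _)
    refine (mul_eq_zero.1 h1).resolve_left ?_
    rw [← hpd]
    exact ENNReal.toReal_ne_zero.2 ⟨hz, p.apply_ne_top z⟩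
  · exact tendsto_finsetSum _ fun i _ => (tendsto_pi_nhds.1 hlim i).const_mul _
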